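/- **Theorem 2 (one-shot version of quantum state redistribution).** All systems are finite-dimensional; $d_X$ is the dimension of $X$, $\|M\|_1=\mathrm{Tr}\sqrt{M^\dagger M}$ is the trace norm, a pure state and its density operator are denoted by the same letter, $\chi_X$ is the reduced state of $\chi$ on $X$, and $M\cdot\rho=M\rho M^\dagger$. Let $C=C_1C_2C_3$ (tensor product), let $A''$ be a duplicate of $A$, $B'$ a duplicate of $B$, and $C'$, $C''$ duplicates of $C$. Let $\Phi_{C_1B_1}$ and $\Phi_{C_2A_2}$ be maximally entangled pure states (both reduced states are maximally mixed, so $d_{B_1}=d_{C_1}$ and $d_{A_2}=d_{C_2}$). Let $\varphi_{CABR}$ be a pure state, and let $\hat\varphi_{CABR}$ and $\check\varphi_{CABR}$ be arbitrary pure states (the reference states). Let $\varphi_{C''A''BR}$ and $\varphi_{C'AB'R}$ be the same state as $\varphi_{CABR}$ on the duplicated systems, and put $$\Upsilon_{initial}=\Phi_{C_2A_2}\otimes\varphi_{C''A''BR},\qquad \Upsilon_{final}=\Phi_{C_1B_1}\otimes\varphi_{C'AB'R}.$$ Then there are isometries $V_{C_2C_3B\to B_1C'B'}$ and $W_{C_1C_3A\to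 A_2C''A''}$ (each acting as the identity on the remaining systems) such that $$\|(V\circ W^{-1})\cdot\Upsilon_{initial}-\Upsilon_{final}\|_1\le\Delta_1+\Delta_2,\qquad \|(W\circ V^{-1})\cdot\Upsilon_{final}-\Upsilon_{initial}\|_1\le\Delta_1+\Delta_2,$$ where $W^{-1}=W^\dagger$ and $V^{-1}=V^\dagger$ denote the adjoints, which invert the isometries on their ranges and vanish on the orthogonal complements, $\Delta_i=\gamma_i+\eta_i$, and $$\gamma_1=2\|\varphi_{CABR}-\hat\varphi_{CABR}\|_1,\qquad \gamma_2=2\|\varphi_{CABR}-\check\varphi_{CABR}\|_1,$$ $$\eta_1=2\sqrt[4]{\frac{2\,d_C\,d_{BR}\,\mathrm{Tr}(\hat\varphi_{CBR}^2)}{d_{C_1C_3}^2}},\qquad \eta_2=2\sqrt[4]{\frac{2\,d_C\,d_{AR}\,\mathrm{Tr}(\check\varphi_{CAR}^2)}{d_{C_2C_3}^2}}.$$ -/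

import Mathlib

open scoped Kronecker

noncomputable section

namespace QSR

/-! A finite-dimensional quantum system is given by a finite index type for an orthonormal basis of
its Hilbert space; the composite of two systems is indexed by the product type. -/

/-- `ψ` is a normalized state vector. -/
def IsPureState {ι : Type*} [Fintype ι] (ψ : ι → ℂ) : Prop :=
  ∑ i, ‖ψ i‖ ^ 2 = 1

/-- The density operator `|ψ⟩⟨ψ|`. -/
def density {ι : Type*} (ψ : ι → ℂ) : Matrix ι ι ℂ :=
  Matrix.vecMulVec ψ (star ψ)

/-- The trace norm `Tr √(Mᴴ M)`. -/
def traceNorm {ι : Type*} [Fintype ι] [DecidableEq ι] (M : Matrix ι ι ℂ) : ℝ :=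
  (cfc Real.sqrt (M.conjTranspose * M)).trace.re

/-- The partial trace over the second factor. -/
def traceSnd {ι τ : Type*} [Fintype τ] (ρ : Matrix (ι × τ) (ι × τ) ℂ) : Matrix ι ι ℂ :=
  fun i j => ∑ t, ρ (i, t) (j, t)

/-- The partial trace over the first factor. -/
def traceFst {τ ι : Type*} [Fintype τ] (ρ : Matrix (τ × ι) (τ × ι) ℂ) : Matrix ι ι ℂ :=
  fun i j => ∑ t, ρ (t, i) (t, j)

/-- The maximally mixed state `1 / d`. -/
def maxMixed (ι : Type*) [Fintype ι] [DecidableEq ι] : Matrix ι ι ℂ :=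
  ((Fintype.card ι : ℂ))⁻¹ • (1 : Matrix ι ι ℂ)

/-- A pure state of a bipartite system is maximally entangled if both of its reduced states are
maximally mixed (in particular the two systems have the same dimension). -/
structure IsMaxEntangled {ι κ : Type*} [Fintype ι] [DecidableEq ι] [Fintype κ] [DecidableEq κ]
    (Φ : ι × κ → ℂ) : Prop where
  pure : IsPureState Φ
  fst : traceSnd (density Φ) = maxMixed ι
  snd : traceFst (density Φ) = maxMixed κ

/-- The purity `Tr (ρ²)`. -/
def purity {ι : Type*} [Fintype ι] (ρ : Matrix ι ι ℂ) : ℝ :=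
  (ρ * ρ).trace.re

/-- The action `M · ρ = M ρ Mᴴ`. -/
def act {ι κ : Type*} [Fintype ι] (M : Matrix κ ι ℂ) (ρ : Matrix ι ι ℂ) : Matrix κ κ ℂ :=
  M * ρ * M.conjTranspose

/-- `K` is an isometry. -/
def IsIsometry {ι κ : Type*} [Fintype κ] [DecidableEq ι] (K : Matrix κ ι ℂ) : Prop :=
  K.conjTranspose * K = 1

/-! In what follows `C = C₁ C₂ C₃`; the duplicates of `A`, `B`, `C` carry the same index types
as the originals. -/

/-- The reduced state on `C B R` of a state of `C A B R`. -/
def reducedCBR {C A B R : Type*} [Fintype A] (ρ : Matrix (C × A × B × R) (C × A × B × R) ℂ) :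
    Matrix (C × B × R) (C × B × R) ℂ :=
  traceSnd (ρ.submatrix
    (fun x : (C × B × R) × A => (x.1.1, x.2, x.1.2.1, x.1.2.2))
    (fun x : (C × B × R) × A => (x.1.1, x.2, x.1.2.1, x.1.2.2)))

/-- The reduced state on `C A R` of a state of `C A B R`. -/
def reducedCAR {C A B R : Type*} [Fintype B] (ρ : Matrix (C × A × B × R) (C × A × B × R) ℂ) :
    Matrix (C × A × R) (C × A × R) ℂ :=
  traceSnd (ρ.submatrix
    (fun x : (C × A × R) × B => (x.1.1, x.1.2.1, x.2, x.1.2.2))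
    (fun x : (C × A × R) × B => (x.1.1, x.1.2.1, x.2, x.1.2.2)))

/-- `(C₁ C₂ C₃) A B R = (C₁ C₃ A) (C₂ B R)`. -/
def splitAlice (C₁ C₂ C₃ A B R : Type*) :
    (C₁ × C₂ × C₃) × A × B × R ≃ (C₁ × C₃ × A) × (C₂ × B × R) where
  toFun x := ((x.1.1, x.1.2.2, x.2.1), (x.1.2.1, x.2.2.1, x.2.2.2))
  invFun y := ((y.1.1, y.2.1, y.1.2.1), y.1.2.2, y.2.2.1, y.2.2.2)
  left_inv _ := rfl
  right_inv _ := rfl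

/-- `(C₂ A₂) (C'' A'' B R) = (A₂ C'' A'') (C₂ B R)`. -/
def splitInitial (C₂ A₂ C A B R : Type*) :
    (C₂ × A₂) × (C × A × B × R) ≃ (A₂ × C × A) × (C₂ × B × R) where
  toFun x := ((x.1.2, x.2.1, x.2.2.1), (x.1.1, x.2.2.2.1, x.2.2.2.2))
  invFun y := ((y.2.1, y.1.1), (y.1.2.1, y.1.2.2, y.2.2.1, y.2.2.2))
  left_inv _ := rfl
  right_inv _ := rfl

/-- `(C₁ C₂ C₃) A B R = (C₂ C₃ B) (C₁ A R)`. -/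
def splitBob (C₁ C₂ C₃ A B R : Type*) :
    (C₁ × C₂ × C₃) × A × B × R ≃ (C₂ × C₃ × B) × (C₁ × A × R) where
  toFun x := ((x.1.2.1, x.1.2.2, x.2.2.1), (x.1.1, x.2.1, x.2.2.2))
  invFun y := ((y.2.1, y.1.1, y.1.2.1), y.2.2.1, y.1.2.2, y.2.2.2)
  left_inv _ := rfl
  right_inv _ := rfl

/-- `(C₁ B₁) (C' A B' R) = (B₁ C' B') (C₁ A R)`. -/
def splitFinal (C₁ B₁ C A B R : Type*) :
    (C₁ × B₁) × (C × A × B × R) ≃ (B₁ × C × B) × (C₁ × A × R) where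
  toFun x := ((x.1.2, x.2.1, x.2.2.2.1), (x.1.1, x.2.2.1, x.2.2.2.2))
  invFun y := ((y.2.1, y.1.1), (y.1.2.1, y.2.2.1, y.1.2.2, y.2.2.2))
  left_inv _ := rfl
  right_inv _ := rfl

variable {C₁ C₂ C₃ A B R A₂ B₁ : Type*}

/-- `W : C₁ C₃ A → A₂ C'' A''` as an operator on the whole system, acting as the identity on
`C₂ B R`. -/
def extendW [DecidableEq C₂] [DecidableEq B] [DecidableEq R]
    (W : Matrix (A₂ × (C₁ × C₂ × C₃) × A) (C₁ × C₃ × A) ℂ) :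
    Matrix ((C₂ × A₂) × ((C₁ × C₂ × C₃) × A × B × R)) ((C₁ × C₂ × C₃) × A × B × R) ℂ :=
  (W ⊗ₖ (1 : Matrix (C₂ × B × R) (C₂ × B × R) ℂ)).submatrix
    (splitInitial C₂ A₂ (C₁ × C₂ × C₃) A B R) (splitAlice C₁ C₂ C₃ A B R)

/-- `V : C₂ C₃ B → B₁ C' B'` as an operator on the whole system, acting as the identity on
`C₁ A R`. -/
def extendV [DecidableEq C₁] [DecidableEq A] [DecidableEq R]
    (V : Matrix (B₁ × (C₁ × C₂ × C₃) × B) (C₂ × C₃ × B) ℂ) :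
    Matrix ((C₁ × B₁) × ((C₁ × C₂ × C₃) × A × B × R)) ((C₁ × C₂ × C₃) × A × B × R) ℂ :=
  (V ⊗ₖ (1 : Matrix (C₁ × A × R) (C₁ × A × R) ℂ)).submatrix
    (splitFinal C₁ B₁ (C₁ × C₂ × C₃) A B R) (splitBob C₁ C₂ C₃ A B R)

/-- `γ = 2 ‖φ - χ‖₁`, for a state `φ` and a reference state `χ`. -/
def gammaError {ι : Type*} [Fintype ι] [DecidableEq ι] (φ χ : ι → ℂ) : ℝ :=
  2 * traceNorm (density φ - density χ)

/-- `η₁ = 2 (2 d_C d_{BR} Tr(χ_{CBR}²) / d_{C₁C₃}²)^{1/4}`. -/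
def etaOne [Fintype C₁] [Fintype C₂] [Fintype C₃] [Fintype A] [Fintype B] [Fintype R]
    (χ : (C₁ × C₂ × C₃) × A × B × R → ℂ) : ℝ :=
  2 * (2 * (Fintype.card (C₁ × C₂ × C₃) : ℝ) * (Fintype.card (B × R) : ℝ)
      * purity (reducedCBR (density χ)) / (Fintype.card (C₁ × C₃) : ℝ) ^ 2) ^ (1 / 4 : ℝ)

/-- `η₂ = 2 (2 d_C d_{AR} Tr(χ_{CAR}²) / d_{C₂C₃}²)^{1/4}`. -/
def etaTwo [Fintype C₁] [Fintype C₂] [Fintype C₃] [Fintype A] [Fintype B] [Fintype R]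
    (χ : (C₁ × C₂ × C₃) × A × B × R → ℂ) : ℝ :=
  2 * (2 * (Fintype.card (C₁ × C₂ × C₃) : ℝ) * (Fintype.card (A × R) : ℝ)
      * purity (reducedCAR (density χ)) / (Fintype.card (C₂ × C₃) : ℝ) ^ 2) ^ (1 / 4 : ℝ)

end QSR

end

/-!
The unitary `U` which both isometries are measured against does not occur in the statement. Suppose
that `W` takes `U · φ` close to the initial state, and that `V` takes the same `U · φ` close to the
final state. Then `V Wᴴ` takes the initial state close to the final one, with an error at most the
sum of the two, and `W Vᴴ` goes back (`traceNorm_act_mul_conjTranspose_sub_le`). Replacing `φ` by a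
reference state costs `γ` (`traceNorm_act_sub_le_gammaError_add`), so it remains to find, for the
reference states, a `U` for which both isometries exist with errors `η₁` and `η₂`.

*Uhlmann's theorem.* The initial state has the reduced state `1 / d ⊗ φ_{BR}` on `C₂ B R`, so `W`
exists as soon as the reduced state of `U · φ` is close to this product, that is, as soon as `U`
decouples `C₂` from `B R`; for `V` it is `C₁` and `A R`. In `exists_isometry_frobSq_mul_sub_le` the
distance of the purifications is bounded directly in terms of the Hilbert–Schmidt distance of the
reduced states: the overlap attained by the best isometry is a sum of singular values, which
dominates `Tr (√ρ √σ)`, and the latter is controlled by a Powers–Størmer inequality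
(`frobSq_sub_le_of_posSemidef`).

*Decoupling.* The squared Hilbert–Schmidt distance to the decoupled state is a sum, over the blocks
of the reduced state with respect to the untouched systems, of terms `‖T (U m Uᴴ)‖²`, where `T` is
the partial trace minus its scalar part (`defect`). Over a unitary 2-design such a term is on
average at most `‖m‖² / d_E`, with `E` the system traced out (`sum_design_frobSq_defect_le`).
Instead of Haar measure a finite family is used: a random monomial matrix, with phases in the third
roots of unity, preceded with probability `d_C / (d_C + 1)` by random phases and a Fourier
transform. The monomial matrices alone symmetrize the quadratic form `‖T m‖²` to a combination of
the squared norm of `m`, the squared norm of its diagonal and `|Tr m|²`; the mixture with the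
Fourier transform gives the diagonal the weight that it has under Haar measure. One `U` serves for
both systems because both averages are under control and the terms are nonnegative
(`exists_isometry_sum_frobSq_defect_le`); this is where the factor `2` in `η` comes from.
-/

noncomputable section

namespace QSR

/-! ### Contractions -/

section Contraction

open scoped Matrix.Norms.L2Operator

variable {ι κ τ : Type*} [Fintype ι] [DecidableEq ι] [Fintype κ] [DecidableEq κ]
  [Fintype τ] [DecidableEq τ]

/-- A rectangular matrix of operator norm at most one. -/
def IsContraction (Y : Matrix κ ι ℂ) : Prop :=
  ‖Y‖ ≤ 1

theorem IsContraction.mul {ι κ τ : Type*} [Fintype ι] [DecidableEq ι] [Fintype κ]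
    [Fintype τ] [DecidableEq τ]
    {Y : Matrix κ ι ℂ} {Z : Matrix ι τ ℂ} (hY : IsContraction Y)
    (hZ : IsContraction Z) : IsContraction (Y * Z) :=
  (Matrix.l2_opNorm_mul Y Z).trans (mul_le_one₀ hY (norm_nonneg _) hZ)

theorem IsContraction.conjTranspose {Y : Matrix κ ι ℂ} (hY : IsContraction Y) :
    IsContraction Y.conjTranspose := by
  rw [IsContraction, Matrix.l2_opNorm_conjTranspose]
  exact hY

theorem IsContraction.of_conjTranspose_mul_self_eq_diagonal {ι κ : Type*} [Fintype ι]
    [DecidableEq ι] [Fintype κ]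
    {Y : Matrix κ ι ℂ} {d : ι → ℂ}
    (hY : Y.conjTranspose * Y = Matrix.diagonal d) (hd : ∀ i, ‖d i‖ ≤ 1) : IsContraction Y := by
  have h := Matrix.l2_opNorm_conjTranspose_mul_self Y
  rw [hY, Matrix.l2_opNorm_diagonal] at h
  have h1 : ‖d‖ ≤ 1 := (pi_norm_le_iff_of_nonneg zero_le_one).2 hd
  rw [IsContraction]
  nlinarith [norm_nonneg Y]

theorem IsIsometry.isContraction {ι κ : Type*} [Fintype ι] [DecidableEq ι] [Fintype κ]
    {W : Matrix κ ι ℂ} (hW : IsIsometry W) : IsContraction W :=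
  .of_conjTranspose_mul_self_eq_diagonal (d := fun _ => 1) (hW.trans Matrix.diagonal_one.symm)
    (by simp)

theorem IsContraction.sum_norm_sq_mulVec_le {ι κ : Type*} [Fintype ι] [DecidableEq ι] [Fintype κ]
    {Y : Matrix κ ι ℂ} (hY : IsContraction Y)
    (v : ι → ℂ) : ∑ k, ‖Y.mulVec v k‖ ^ 2 ≤ ∑ i, ‖v i‖ ^ 2 := by
  have h := (Matrix.l2_opNorm_mulVec Y (WithLp.toLp 2 v)).trans
    (mul_le_of_le_one_left (norm_nonneg _) hY)
  have h2 := pow_le_pow_left₀ (norm_nonneg _) h 2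
  rw [EuclideanSpace.norm_sq_eq, EuclideanSpace.norm_sq_eq] at h2
  simpa using h2

theorem IsContraction.sum_norm_sq_col_le {ι κ : Type*} [Fintype ι] [DecidableEq ι] [Fintype κ]
    {Y : Matrix κ ι ℂ} (hY : IsContraction Y) (i : ι) :
    ∑ k, ‖Y k i‖ ^ 2 ≤ 1 := by
  have h := hY.sum_norm_sq_mulVec_le (Pi.single i 1)
  simpa [Pi.single_apply, apply_ite, Finset.sum_ite_eq'] using h

end Contraction

theorem norm_sum_star_mul_le {ι : Type*} [Fintype ι] (a b : ι → ℂ) :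
    ‖∑ i, star (a i) * b i‖ ≤ √(∑ i, ‖a i‖ ^ 2) * √(∑ i, ‖b i‖ ^ 2) := by
  refine (norm_sum_le _ _).trans ?_
  simp_rw [norm_mul, norm_star]
  exact Real.sum_mul_le_sqrt_mul_sqrt _ _ _

/-! ### Singular values -/

section SingularSum

variable {ι κ : Type*} [Fintype ι] [DecidableEq ι] [Fintype κ] [DecidableEq κ]

/-- The sum of the singular values, that is, of the square roots of the eigenvalues of `Kᴴ K`; this
extends the trace norm to rectangular matrices. -/
def singularSum (K : Matrix κ ι ℂ) : ℝ :=
  ∑ i, √((Matrix.isHermitian_conjTranspose_mul_self K).eigenvalues i)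

theorem traceNorm_eq_singularSum (M : Matrix ι ι ℂ) : traceNorm M = singularSum M := by
  have hH := Matrix.isHermitian_conjTranspose_mul_self M
  rw [traceNorm, hH.cfc_eq, Matrix.IsHermitian.cfc, Unitary.conjStarAlgAut_apply,
    Matrix.trace_mul_comm, ← mul_assoc]
  simp [singularSum, Matrix.trace]

/-- In an eigenbasis of `Kᴴ K` the columns of `K` are orthogonal. -/
theorem conjTranspose_mul_self_mul_eigenvectors {ι κ : Type*} [Fintype ι] [DecidableEq ι]
    [Fintype κ]
    (K : Matrix κ ι ℂ) :
    let hH := Matrix.isHermitian_conjTranspose_mul_self K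
    let V : Matrix ι ι ℂ := hH.eigenvectorUnitary
    (K * V).conjTranspose * (K * V) = Matrix.diagonal (fun i => (hH.eigenvalues i : ℂ)) := by
  intro hH V
  have h := hH.conjStarAlgAut_star_eigenvectorUnitary
  rw [Unitary.conjStarAlgAut_apply] at h
  simp only [Unitary.coe_star, star_star] at h
  rw [Matrix.conjTranspose_mul, Matrix.mul_assoc, ← Matrix.mul_assoc K.conjTranspose,
    ← Matrix.mul_assoc]
  exact h

theorem sum_norm_sq_col_mul_eigenvectors {ι κ : Type*} [Fintype ι] [DecidableEq ι] [Fintype κ]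
    (K : Matrix κ ι ℂ) (i : ι) :
    ∑ k, ‖(K * (Matrix.isHermitian_conjTranspose_mul_self K).eigenvectorUnitary.1) k i‖ ^ 2
      = (Matrix.isHermitian_conjTranspose_mul_self K).eigenvalues i := by
  have h := congrFun (congrFun (conjTranspose_mul_self_mul_eigenvectors K) i) i
  rw [Matrix.mul_apply] at h
  simp only [Matrix.conjTranspose_apply, Matrix.diagonal_apply_eq] at h
  have h2 : ∀ z : ℂ, star z * z = ((‖z‖ ^ 2 : ℝ) : ℂ) := fun z => by
    rw [Complex.star_def, Complex.conj_mul']; push_cast; rfl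
  simp_rw [h2] at h
  exact_mod_cast h

theorem trace_conjTranspose_mul_eq_sum {ι κ : Type*} [Fintype ι] [DecidableEq ι] [Fintype κ]
    (Y K : Matrix κ ι ℂ) (V : Matrix ι ι ℂ)
    (hV : V * V.conjTranspose = 1) :
    (Y.conjTranspose * K).trace = ∑ i, ∑ k, star ((Y * V) k i) * (K * V) k i := by
  have h : (Y.conjTranspose * K).trace = ((Y * V).conjTranspose * (K * V)).trace := by
    rw [Matrix.conjTranspose_mul, Matrix.mul_assoc V.conjTranspose,
      Matrix.trace_mul_comm V.conjTranspose,
      Matrix.mul_assoc, Matrix.mul_assoc, hV, Matrix.mul_one]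
  rw [h]
  rfl

/-- One half of the duality between the trace norm and the operator norm. -/
theorem IsContraction.re_trace_le_singularSum {ι κ : Type*} [Fintype ι] [DecidableEq ι]
    [Fintype κ] {Y : Matrix κ ι ℂ} (hY : IsContraction Y)
    (K : Matrix κ ι ℂ) : (Y.conjTranspose * K).trace.re ≤ singularSum K := by
  have hU := (Matrix.isHermitian_conjTranspose_mul_self K).eigenvectorUnitary.2
  rw [trace_conjTranspose_mul_eq_sum Y K _ (Matrix.mem_unitaryGroup_iff.1 hU), Complex.re_sum,
    singularSum]
  refine Finset.sum_le_sum fun i _ => (Complex.re_le_norm _).trans ?_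
  refine (norm_sum_star_mul_le _ _).trans ?_
  rw [sum_norm_sq_col_mul_eigenvectors]
  have hV : IsContraction
      ((Matrix.isHermitian_conjTranspose_mul_self K).eigenvectorUnitary : Matrix ι ι ℂ) :=
    IsIsometry.isContraction (Matrix.mem_unitaryGroup_iff'.1 hU)
  exact mul_le_of_le_one_left (Real.sqrt_nonneg _)
    (Real.sqrt_le_one.2 ((hY.mul hV).sum_norm_sq_col_le i))

/-- The other half of the duality: the supremum is attained at an isometry, which sends each
eigenvector `v` of `Kᴴ K` with `K v ≠ 0` to the normalization of `K v`, and the other eigenvectors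
to a completion of these to an orthonormal family. -/
theorem exists_isometry_re_trace_eq_singularSum (hcard : Fintype.card ι ≤ Fintype.card κ)
    (K : Matrix κ ι ℂ) :
    ∃ W : Matrix κ ι ℂ, IsIsometry W ∧ (W.conjTranspose * K).trace.re = singularSum K := by
  obtain ⟨emb⟩ := Function.Embedding.nonempty_of_card_le hcard
  set hH := Matrix.isHermitian_conjTranspose_mul_self K
  set V : Matrix ι ι ℂ := hH.eigenvectorUnitary.1
  have hU := hH.eigenvectorUnitary.2
  have hV1 : V * V.conjTranspose = 1 := Matrix.mem_unitaryGroup_iff.1 hU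
  have hV2 : V.conjTranspose * V = 1 := Matrix.mem_unitaryGroup_iff'.1 hU
  set l : ι → ℝ := hH.eigenvalues with hl
  have hgram : (K * V).conjTranspose * (K * V) = Matrix.diagonal (fun i => (l i : ℂ)) :=
    conjTranspose_mul_self_mul_eigenvectors K
  have hcol : ∀ i, ∑ k, ‖(K * V) k i‖ ^ 2 = l i := sum_norm_sq_col_mul_eigenvectors K
  have hl0 : ∀ i, 0 ≤ l i := fun i => by rw [← hcol]; positivity
  -- the normalized nonzero columns of `K V`, placed at the positions `emb i`
  let u : ι → EuclideanSpace ℂ κ := fun i =>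
    WithLp.toLp 2 fun k => (((√(l i))⁻¹ : ℝ) : ℂ) * (K * V) k i
  let v : κ → EuclideanSpace ℂ κ := Function.extend emb u 0
  have hvu : ∀ i, v (emb i) = u i := fun i => emb.injective.extend_apply u 0 i
  have huu : ∀ i j, inner ℂ (u i) (u j)
      = (((√(l i))⁻¹ * (√(l j))⁻¹ : ℝ) : ℂ) * (if i = j then (l i : ℂ) else 0) := by
    intro i j
    have h := congrFun (congrFun hgram i) j
    rw [Matrix.mul_apply, Matrix.diagonal_apply] at h
    rw [← h, Finset.mul_sum, PiLp.inner_apply]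
    refine Finset.sum_congr rfl fun k _ => ?_
    simp only [u, RCLike.inner_apply, Matrix.conjTranspose_apply, map_mul, Complex.ofReal_mul,
      Complex.conj_ofReal, Complex.star_def]
    ring
  have hon : Orthonormal ℂ ((emb '' {i | l i ≠ 0}).domRestrict v) := by
    rw [orthonormal_iff_ite]
    rintro ⟨_, i, hi, rfl⟩ ⟨_, j, hj, rfl⟩
    simp only [Set.domRestrict_apply, hvu, huu]
    by_cases hij : i = j
    · subst hij
      have h2 : √(l i) ≠ 0 := (Real.sqrt_pos.2 (lt_of_le_of_ne (hl0 i) (Ne.symm hi))).ne'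
      rw [if_pos rfl, if_pos rfl, ← Complex.ofReal_mul, ← Complex.ofReal_one]
      congr 1
      nth_rewrite 3 [← Real.mul_self_sqrt (hl0 i)]
      field_simp
    · rw [if_neg hij, mul_zero,
        if_neg fun h => hij (emb.injective (congrArg Subtype.val h))]
  obtain ⟨b, hb⟩ := hon.exists_orthonormalBasis_extension_of_card_eq (by simp)
  let W₀ : Matrix κ ι ℂ := Matrix.of fun k i => b (emb i) k
  have hW₀ : W₀.conjTranspose * W₀ = 1 := by
    ext i j
    have h := orthonormal_iff_ite.1 b.orthonormal (emb i) (emb j)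
    rw [PiLp.inner_apply] at h
    simp only [emb.injective.eq_iff] at h
    rw [Matrix.mul_apply, Matrix.one_apply, ← h]
    refine Finset.sum_congr rfl fun k _ => ?_
    simp [W₀, mul_comm]
  refine ⟨W₀ * V.conjTranspose, ?_, ?_⟩
  · rw [IsIsometry, Matrix.conjTranspose_mul, Matrix.conjTranspose_conjTranspose,
      Matrix.mul_assoc, ← Matrix.mul_assoc W₀.conjTranspose, hW₀, Matrix.one_mul, hV1]
  · rw [trace_conjTranspose_mul_eq_sum _ K V hV1, Matrix.mul_assoc, hV2, Matrix.mul_one,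
      Complex.re_sum, singularSum]
    refine Finset.sum_congr rfl fun i _ => ?_
    change _ = √(l i)
    by_cases hi : l i = 0
    · have h0 : ∀ k, (K * V) k i = 0 := by
        intro k
        have := (Finset.sum_eq_zero_iff_of_nonneg (fun k _ => by positivity)).1
          ((hcol i).trans hi) k (Finset.mem_univ k)
        simpa using this
      simp [h0, hi]
    · have hbi : b (emb i) = u i := (hb _ ⟨i, hi, rfl⟩).trans (hvu i)
      have h1 : √(l i) ≠ 0 := (Real.sqrt_pos.2 (lt_of_le_of_ne (hl0 i) (Ne.symm hi))).ne'
      have h2 : ∀ k, star (W₀ k i) * (K * V) k i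
          = (((√(l i))⁻¹ * ‖(K * V) k i‖ ^ 2 : ℝ) : ℂ) := by
        intro k
        simp only [W₀, Matrix.of_apply, hbi, u, star_mul', Complex.star_def, Complex.conj_ofReal]
        rw [mul_assoc, Complex.conj_mul']
        push_cast
        rfl
      simp_rw [h2]
      rw [← Complex.ofReal_sum, Complex.ofReal_re, ← Finset.mul_sum, hcol]
      nth_rewrite 2 [← Real.mul_self_sqrt (hl0 i)]
      field_simp

end SingularSum

/-! ### The trace norm -/

section TraceNorm

variable {ι κ : Type*} [Fintype ι] [DecidableEq ι] [Fintype κ] [DecidableEq κ]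

theorem traceNorm_le_of_forall_contraction {M : Matrix ι ι ℂ} {r : ℝ}
    (h : ∀ Y : Matrix ι ι ℂ, IsContraction Y → (Y * M).trace.re ≤ r) : traceNorm M ≤ r := by
  obtain ⟨W, hW, hWM⟩ := exists_isometry_re_trace_eq_singularSum le_rfl M
  rw [traceNorm_eq_singularSum, ← hWM]
  exact h _ hW.isContraction.conjTranspose

theorem IsContraction.re_trace_mul_le_traceNorm {Y : Matrix ι ι ℂ} (hY : IsContraction Y)
    (M : Matrix ι ι ℂ) : (Y * M).trace.re ≤ traceNorm M := by
  simpa [traceNorm_eq_singularSum] using hY.conjTranspose.re_trace_le_singularSum M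

theorem traceNorm_add_le (M N : Matrix ι ι ℂ) :
    traceNorm (M + N) ≤ traceNorm M + traceNorm N := by
  refine traceNorm_le_of_forall_contraction fun Y hY => ?_
  rw [Matrix.mul_add, Matrix.trace_add, Complex.add_re]
  exact add_le_add (hY.re_trace_mul_le_traceNorm M) (hY.re_trace_mul_le_traceNorm N)

theorem traceNorm_neg (M : Matrix ι ι ℂ) : traceNorm (-M) = traceNorm M := by
  simp [traceNorm]

theorem traceNorm_sub_rev (M N : Matrix ι ι ℂ) : traceNorm (M - N) = traceNorm (N - M) := by
  rw [← traceNorm_neg, neg_sub]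

theorem traceNorm_sub_le (L M N : Matrix ι ι ℂ) :
    traceNorm (L - N) ≤ traceNorm (L - M) + traceNorm (M - N) := by
  simpa using traceNorm_add_le (L - M) (M - N)

theorem IsContraction.traceNorm_act_le {K : Matrix κ ι ℂ} (hK : IsContraction K)
    (M : Matrix ι ι ℂ) : traceNorm (act K M) ≤ traceNorm M := by
  refine traceNorm_le_of_forall_contraction fun Y hY => ?_
  have h : (Y * act K M).trace = (K.conjTranspose * Y * K * M).trace := by
    rw [act, ← Matrix.mul_assoc, Matrix.trace_mul_comm, ← Matrix.mul_assoc, ← Matrix.mul_assoc]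
  rw [h]
  exact ((hK.conjTranspose.mul hY).mul hK).re_trace_mul_le_traceNorm M

theorem trace_mul_vecMulVec_star {ι : Type*} [Fintype ι]
    (Y : Matrix ι ι ℂ) (a b : ι → ℂ) :
    (Y * Matrix.vecMulVec a (star b)).trace = ∑ i, star (b i) * Y.mulVec a i := by
  rw [Matrix.mul_vecMulVec, Matrix.trace_vecMulVec, dotProduct]
  exact Finset.sum_congr rfl fun i _ => by rw [mul_comm]; rfl

theorem traceNorm_vecMulVec_le (a b : ι → ℂ) :
    traceNorm (Matrix.vecMulVec a (star b)) ≤ √(∑ i, ‖a i‖ ^ 2) * √(∑ i, ‖b i‖ ^ 2) := by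
  refine traceNorm_le_of_forall_contraction fun Y hY => (Complex.re_le_norm _).trans ?_
  rw [trace_mul_vecMulVec_star, mul_comm]
  exact (norm_sum_star_mul_le _ _).trans
    (mul_le_mul_of_nonneg_left (Real.sqrt_le_sqrt (hY.sum_norm_sq_mulVec_le a))
      (Real.sqrt_nonneg _))

theorem traceNorm_density_sub_le {a b : ι → ℂ} (ha : IsPureState a) (hb : IsPureState b) :
    traceNorm (density a - density b) ≤ 2 * √(∑ i, ‖a i - b i‖ ^ 2) := by
  have h : density a - density b
      = Matrix.vecMulVec (a - b) (star a) + Matrix.vecMulVec b (star (a - b)) := by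
    ext i j
    simp [density, Matrix.vecMulVec_apply]
    ring
  rw [h]
  refine (traceNorm_add_le _ _).trans ?_
  have h1 := traceNorm_vecMulVec_le (a - b) a
  have h2 := traceNorm_vecMulVec_le b (a - b)
  rw [ha] at h1
  rw [hb] at h2
  simp only [Real.sqrt_one, mul_one, one_mul, Pi.sub_apply] at h1 h2
  linarith

theorem act_density {ι κ : Type*} [Fintype ι]
    (K : Matrix κ ι ℂ) (a : ι → ℂ) : act K (density a) = density (K.mulVec a) := by
  rw [act, density, density, Matrix.mul_vecMulVec, Matrix.vecMulVec_mul, Matrix.star_mulVec]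

end TraceNorm

/-! ### Hilbert–Schmidt norm and Uhlmann's theorem -/

section Frobenius

open scoped ComplexOrder

variable {ι κ τ : Type*} [Fintype ι] [DecidableEq ι] [Fintype κ] [DecidableEq κ]
  [Fintype τ] [DecidableEq τ]

/-- The square of the Frobenius (Hilbert–Schmidt) norm. -/
def frobSq (M : Matrix κ ι ℂ) : ℝ :=
  ∑ k, ∑ i, ‖M k i‖ ^ 2

theorem frobSq_nonneg {ι κ : Type*} [Fintype ι] [Fintype κ]
    (M : Matrix κ ι ℂ) : 0 ≤ frobSq M := by
  unfold frobSq; positivity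

theorem frobSq_eq_re_trace {ι κ : Type*} [Fintype ι] [Fintype κ]
    (M : Matrix κ ι ℂ) : frobSq M = (M.conjTranspose * M).trace.re := by
  simp only [Matrix.trace, Matrix.diag, Matrix.mul_apply, Matrix.conjTranspose_apply,
    Complex.star_def, Complex.conj_mul', Complex.re_sum]
  rw [frobSq, Finset.sum_comm]
  refine Finset.sum_congr rfl fun i _ => Finset.sum_congr rfl fun k _ => ?_
  norm_cast

theorem frobSq_conjTranspose {ι κ : Type*} [Fintype ι] [Fintype κ]
    (M : Matrix κ ι ℂ) : frobSq M.conjTranspose = frobSq M := by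
  rw [frobSq, frobSq, Finset.sum_comm]
  simp

theorem frobSq_isometry_mul {ι κ τ : Type*} [Fintype ι] [DecidableEq ι] [Fintype κ] [Fintype τ]
    {W : Matrix κ ι ℂ} (hW : IsIsometry W) (M : Matrix ι τ ℂ) :
    frobSq (W * M) = frobSq M := by
  have hW' : W.conjTranspose * W = 1 := hW
  rw [frobSq_eq_re_trace, frobSq_eq_re_trace, Matrix.conjTranspose_mul, Matrix.mul_assoc,
    ← Matrix.mul_assoc W.conjTranspose, hW', Matrix.one_mul]

theorem frobSq_conj_unitary {V : Matrix ι ι ℂ} (hV : V * V.conjTranspose = 1)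
    (M : Matrix ι ι ℂ) : frobSq (V.conjTranspose * M * V) = frobSq M := by
  have h : IsIsometry V.conjTranspose := by
    rw [IsIsometry, Matrix.conjTranspose_conjTranspose, hV]
  rw [Matrix.mul_assoc, frobSq_isometry_mul h, ← frobSq_conjTranspose, Matrix.conjTranspose_mul,
    frobSq_isometry_mul h, frobSq_conjTranspose]

theorem frobSq_sub {ι κ : Type*} [Fintype ι] [Fintype κ]
    (M N : Matrix κ ι ℂ) :
    frobSq (M - N) = frobSq M + frobSq N - 2 * (N.conjTranspose * M).trace.re := by
  have h : (M.conjTranspose * N).trace.re = (N.conjTranspose * M).trace.re := by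
    have := Matrix.trace_conjTranspose (N.conjTranspose * M)
    rw [Matrix.conjTranspose_mul, Matrix.conjTranspose_conjTranspose] at this
    rw [this, Complex.star_def, Complex.conj_re]
  simp only [frobSq_eq_re_trace, Matrix.conjTranspose_sub, Matrix.sub_mul, Matrix.mul_sub,
    Matrix.trace_sub, Complex.sub_re, h]
  ring

/-- A version of the Powers–Størmer inequality, with the Frobenius norm on the right-hand side. In
an eigenbasis of `S - T`, the `i`-th diagonal entry of `S² - T²` is the `i`-th eigenvalue of `S - T`
times the diagonal entry of `S + T`, which is at least the absolute value of that eigenvalue. -/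
theorem frobSq_sub_le_of_posSemidef {S T : Matrix ι ι ℂ} (hS : S.PosSemidef) (hT : T.PosSemidef) :
    frobSq (S - T) ≤ √(Fintype.card ι) * √(frobSq (S * S - T * T)) := by
  have hH : (S - T).IsHermitian := hS.1.sub hT.1
  set V : Matrix ι ι ℂ := hH.eigenvectorUnitary.1
  have hU := hH.eigenvectorUnitary.2
  have hV1 : V * V.conjTranspose = 1 := Matrix.mem_unitaryGroup_iff.1 hU
  set l : ι → ℝ := hH.eigenvalues with hl
  set S' := V.conjTranspose * S * V with hS'
  set T' := V.conjTranspose * T * V with hT'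
  have hSp : S'.PosSemidef := hS.conjTranspose_mul_mul_same V
  have hTp : T'.PosSemidef := hT.conjTranspose_mul_mul_same V
  have hdiff : S' - T' = Matrix.diagonal fun i => (l i : ℂ) := by
    have h := hH.conjStarAlgAut_star_eigenvectorUnitary
    rw [Unitary.conjStarAlgAut_apply] at h
    simp only [Unitary.coe_star, star_star] at h
    rw [hS', hT', ← Matrix.sub_mul, ← Matrix.mul_sub]
    exact h
  have hsq : ∀ X : Matrix ι ι ℂ, V.conjTranspose * (X * X) * V
      = (V.conjTranspose * X * V) * (V.conjTranspose * X * V) := fun X => by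
    rw [Matrix.mul_assoc (V.conjTranspose * X), Matrix.mul_assoc V.conjTranspose X V,
      ← Matrix.mul_assoc V V.conjTranspose, hV1, Matrix.one_mul]
    simp only [Matrix.mul_assoc]
  have hZ : V.conjTranspose * (S * S - T * T) * V = S' * S' - T' * T' := by
    rw [Matrix.mul_sub, Matrix.sub_mul, hsq, hsq]
  have hdiag : ∀ i, (S' * S' - T' * T') i i = l i * (S' i i + T' i i) := by
    intro i
    have h1 : S' * S' - T' * T' = (S' - T') * S' + T' * (S' - T') := by noncomm_ring
    rw [h1, hdiff, Matrix.add_apply, Matrix.diagonal_mul, Matrix.mul_diagonal]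
    ring
  have hle : ∀ i, l i ^ 2 ≤ ‖(S' * S' - T' * T') i i‖ := by
    intro i
    have h1 : (0 : ℝ) ≤ (S' i i).re := (Complex.le_def.1 hSp.diag_nonneg).1
    have h2 : (0 : ℝ) ≤ (T' i i).re := (Complex.le_def.1 hTp.diag_nonneg).1
    have h3 : (S' i i).re - (T' i i).re = l i := by
      have := congrArg Complex.re (congrFun (congrFun hdiff i) i)
      simpa using this
    rw [hdiag, norm_mul, Complex.norm_real, Real.norm_eq_abs, ← sq_abs, pow_two]
    refine mul_le_mul_of_nonneg_left (le_trans ?_ (Complex.re_le_norm _)) (abs_nonneg _)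
    rw [Complex.add_re, abs_le]
    constructor <;> linarith
  calc frobSq (S - T) = frobSq (S' - T') := by
        rw [hS', hT', ← Matrix.sub_mul, ← Matrix.mul_sub, frobSq_conj_unitary hV1]
    _ = ∑ i, l i ^ 2 := by
        rw [hdiff, frobSq]
        refine Finset.sum_congr rfl fun i _ => ?_
        rw [Finset.sum_eq_single i (fun j _ hj => by simp [Matrix.diagonal_apply_ne' _ hj])
          (by simp)]
        simp
    _ ≤ ∑ i, 1 * ‖(S' * S' - T' * T') i i‖ := Finset.sum_le_sum fun i _ => by
        rw [one_mul]; exact hle i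
    _ ≤ √(∑ _i : ι, 1 ^ 2) * √(∑ i, ‖(S' * S' - T' * T') i i‖ ^ 2) :=
        Real.sum_mul_le_sqrt_mul_sqrt _ _ _
    _ ≤ √(Fintype.card ι) * √(frobSq (S * S - T * T)) := by
        rw [← frobSq_conj_unitary hV1 (S * S - T * T), hZ]
        refine mul_le_mul (by simp) (Real.sqrt_le_sqrt ?_) (Real.sqrt_nonneg _)
          (Real.sqrt_nonneg _)
        exact Finset.sum_le_sum fun i _ =>
          Finset.single_le_sum (f := fun j => ‖(S' * S' - T' * T') i j‖ ^ 2)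
            (fun j _ => by positivity) (Finset.mem_univ i)

/-- The positive square root `S` of `Mᴴ M` is `Pᴴ M` for some contraction `P`: a weak form of the
polar decomposition, valid without assumptions on the dimensions. -/
theorem exists_contraction_conjTranspose_mul_eq {ι κ : Type*} [Fintype ι] [DecidableEq ι]
    [Fintype κ] (M : Matrix κ ι ℂ) :
    ∃ (P : Matrix κ ι ℂ) (S : Matrix ι ι ℂ), IsContraction P ∧ S.PosSemidef ∧
      P.conjTranspose * M = S ∧ S * S = M.conjTranspose * M := by
  set hH := Matrix.isHermitian_conjTranspose_mul_self M
  set V : Matrix ι ι ℂ := hH.eigenvectorUnitary.1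
  have hU := hH.eigenvectorUnitary.2
  have hV1 : V * V.conjTranspose = 1 := Matrix.mem_unitaryGroup_iff.1 hU
  have hV2 : V.conjTranspose * V = 1 := Matrix.mem_unitaryGroup_iff'.1 hU
  set l : ι → ℝ := hH.eigenvalues with hl
  have hgram : (M * V).conjTranspose * (M * V) = Matrix.diagonal (fun i => (l i : ℂ)) :=
    conjTranspose_mul_self_mul_eigenvectors M
  have hl0 : ∀ i, 0 ≤ l i := fun i => by
    rw [hl, ← sum_norm_sq_col_mul_eigenvectors]; positivity
  have hMM : M.conjTranspose * M
      = V * Matrix.diagonal (fun i => (l i : ℂ)) * V.conjTranspose := by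
    rw [← hgram, Matrix.conjTranspose_mul]
    calc M.conjTranspose * M
        = (V * V.conjTranspose) * (M.conjTranspose * M) * (V * V.conjTranspose) := by
          rw [hV1, Matrix.one_mul, Matrix.mul_one]
      _ = _ := by simp only [Matrix.mul_assoc]
  have hinv : ∀ i, (√(l i))⁻¹ * l i = √(l i) := by
    intro i
    rcases eq_or_ne (√(l i)) 0 with h | h
    · simp [h]
    · nth_rewrite 2 [← Real.mul_self_sqrt (hl0 i)]
      field_simp
  -- `√(l i)⁻¹ = 0` where the eigenvalue `l i` vanishes
  set D : Matrix ι ι ℂ := Matrix.diagonal fun i => (((√(l i))⁻¹ : ℝ) : ℂ) with hD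
  set S : Matrix ι ι ℂ := V * Matrix.diagonal (fun i => ((√(l i) : ℝ) : ℂ)) * V.conjTranspose
    with hS
  have hDH : D.conjTranspose = D := by
    rw [hD, Matrix.diagonal_conjTranspose]
    congr 1
    funext i
    simp
  refine ⟨M * V * D * V.conjTranspose, S, ?_, ?_, ?_, ?_⟩
  · refine IsContraction.mul
      (.of_conjTranspose_mul_self_eq_diagonal
        (d := fun i => (((√(l i))⁻¹ * l i * (√(l i))⁻¹ : ℝ) : ℂ)) ?_ ?_)
      (IsIsometry.isContraction (W := V) hV2).conjTranspose
    · rw [Matrix.conjTranspose_mul, hDH, Matrix.mul_assoc, ← Matrix.mul_assoc _ (M * V) D, hgram,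
        hD, Matrix.diagonal_mul_diagonal, Matrix.diagonal_mul_diagonal]
      congr 1
      funext i
      push_cast
      ring
    · intro i
      rw [hinv, Complex.norm_real, Real.norm_eq_abs]
      rcases eq_or_ne (√(l i)) 0 with h | h
      · simp [h]
      · simp [h]
  · refine Matrix.PosSemidef.mul_mul_conjTranspose_same ?_ V
    refine Matrix.PosSemidef.diagonal fun i => ?_
    exact Complex.zero_le_real.2 (Real.sqrt_nonneg _)
  · rw [Matrix.conjTranspose_mul, Matrix.conjTranspose_mul _ D, Matrix.conjTranspose_conjTranspose,
      hDH, Matrix.conjTranspose_mul M V]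
    calc V * (D * (V.conjTranspose * M.conjTranspose)) * M
        = V * D * V.conjTranspose * (M.conjTranspose * M) := by simp only [Matrix.mul_assoc]
      _ = V * D * (V.conjTranspose * V) * Matrix.diagonal (fun i => (l i : ℂ))
            * V.conjTranspose := by rw [hMM]; simp only [Matrix.mul_assoc]
      _ = S := by
          rw [hV2, Matrix.mul_one, hD, Matrix.mul_assoc V, Matrix.diagonal_mul_diagonal, hS]
          congr 3
          funext i
          rw [← Complex.ofReal_mul, hinv]
  · rw [hMM, hS]
    calc V * Matrix.diagonal (fun i => ((√(l i) : ℝ) : ℂ)) * V.conjTranspose *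
          (V * Matrix.diagonal (fun i => ((√(l i) : ℝ) : ℂ)) * V.conjTranspose)
        = V * Matrix.diagonal (fun i => ((√(l i) : ℝ) : ℂ)) * (V.conjTranspose *
          V) * Matrix.diagonal (fun i => ((√(l i) : ℝ) : ℂ)) * V.conjTranspose := by
          simp only [Matrix.mul_assoc]
      _ = _ := by
          rw [hV2, Matrix.mul_one, Matrix.mul_assoc V, Matrix.diagonal_mul_diagonal]
          congr 3
          funext i
          rw [← Complex.ofReal_mul, Real.mul_self_sqrt (hl0 i)]

/-- Uhlmann's theorem in quantitative form. A matrix `M : κ × ι` is a vector of a bipartite system,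
with reduced state `Mᴴ M` (up to transposition) on `ι`; if `M` and `N` have nearby reduced states,
an isometry on the purifying system takes `M` close to `N`. -/
theorem exists_isometry_frobSq_mul_sub_le (hcard : Fintype.card κ ≤ Fintype.card τ)
    (M : Matrix κ ι ℂ) (N : Matrix τ ι ℂ) :
    ∃ W : Matrix τ κ ℂ, IsIsometry W ∧ frobSq (W * M - N)
      ≤ √(Fintype.card ι) * √(frobSq (M.conjTranspose * M - N.conjTranspose * N)) := by
  obtain ⟨P, S, hP, hS, hPS, hSS⟩ := exists_contraction_conjTranspose_mul_eq M
  obtain ⟨Q, T, hQ, hT, hQT, hTT⟩ := exists_contraction_conjTranspose_mul_eq N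
  obtain ⟨W, hW, hWtr⟩ := exists_isometry_re_trace_eq_singularSum hcard (N * M.conjTranspose)
  refine ⟨W, hW, ?_⟩
  rw [← hSS, ← hTT]
  refine le_trans ?_ (frobSq_sub_le_of_posSemidef hS hT)
  have h1 := (hQ.mul hP.conjTranspose).re_trace_le_singularSum (N * M.conjTranspose)
  have h2 : ((Q * P.conjTranspose).conjTranspose * (N * M.conjTranspose)).trace
      = (T.conjTranspose * S).trace := by
    have h3 : M.conjTranspose * P = S := by
      rw [← hS.1.eq, ← hPS, Matrix.conjTranspose_mul, Matrix.conjTranspose_conjTranspose]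
    rw [Matrix.conjTranspose_mul, Matrix.conjTranspose_conjTranspose, Matrix.mul_assoc,
      ← Matrix.mul_assoc Q.conjTranspose, hQT, Matrix.trace_mul_comm, Matrix.mul_assoc, h3,
      hT.1.eq]
  have h4 : (W.conjTranspose * (N * M.conjTranspose)).trace.re
      = (N.conjTranspose * (W * M)).trace.re := by
    have := Matrix.trace_conjTranspose (N.conjTranspose * (W * M))
    rw [Matrix.conjTranspose_mul, Matrix.conjTranspose_conjTranspose, Matrix.conjTranspose_mul,
      Matrix.mul_assoc, Matrix.trace_mul_comm, Matrix.mul_assoc] at this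
    rw [this, Complex.star_def, Complex.conj_re]
  have h5 : frobSq M = frobSq S := by
    rw [frobSq_eq_re_trace, frobSq_eq_re_trace, hS.1.eq, hSS]
  have h6 : frobSq N = frobSq T := by
    rw [frobSq_eq_re_trace, frobSq_eq_re_trace, hT.1.eq, hTT]
  rw [frobSq_sub, frobSq_sub, frobSq_isometry_mul hW, h5, h6]
  rw [h2] at h1
  linarith

end Frobenius

/-! ### Moments of random phases -/

section Phases

variable {C : Type*} [Fintype C] [DecidableEq C]

/-- The sum of the squared absolute values of the off-diagonal entries. -/
def offSq (m : Matrix C C ℂ) : ℝ :=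
  ∑ i, ∑ j, if i = j then 0 else ‖m i j‖ ^ 2

/-- The sum of the squared absolute values of the diagonal entries. -/
def diagSq (m : Matrix C C ℂ) : ℝ :=
  ∑ i, ‖m i i‖ ^ 2

theorem offSq_add_diagSq (m : Matrix C C ℂ) : offSq m + diagSq m = frobSq m := by
  rw [offSq, diagSq, frobSq, ← Finset.sum_add_distrib]
  refine Finset.sum_congr rfl fun i _ => ?_
  rw [← Finset.add_sum_erase _ _ (Finset.mem_univ i),
    ← Finset.add_sum_erase Finset.univ (fun j => ‖m i j‖ ^ 2) (Finset.mem_univ i), if_pos rfl,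
    zero_add, add_comm]
  congr 1
  exact Finset.sum_congr rfl fun j hj => if_neg (Finset.ne_of_mem_erase hj).symm

instance : Fintype (rootsOfUnity 3 ℂ) :=
  Fintype.ofFinite _

/-- A tuple of third roots of unity, as a vector of complex numbers. -/
def phase (z : C → rootsOfUnity 3 ℂ) (i : C) : ℂ :=
  ((z i : ℂˣ) : ℂ)

theorem norm_phase {C : Type*}
    (z : C → rootsOfUnity 3 ℂ) (i : C) : ‖phase z i‖ = 1 := by
  have h : phase z i ^ 3 = 1 := by
    have := (mem_rootsOfUnity' 3 (z i : ℂˣ)).1 (z i).2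
    simpa [phase] using this
  exact Complex.norm_eq_one_of_pow_eq_one h (by norm_num)

theorem star_phase_mul_phase {C : Type*}
    (z : C → rootsOfUnity 3 ℂ) (i : C) :
    star (phase z i) * phase z i = 1 := by
  rw [Complex.star_def, Complex.conj_mul', norm_phase]
  simp

theorem exists_rootsOfUnity_three : ∃ ζ : rootsOfUnity 3 ℂ,
    ((ζ : ℂˣ) : ℂ) ≠ 1 ∧ ((ζ : ℂˣ) : ℂ) * ((ζ : ℂˣ) : ℂ) ≠ 1 := by
  have h := Complex.isPrimitiveRoot_exp 3 (by norm_num)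
  refine ⟨h.toRootsOfUnity, ?_, ?_⟩
  · exact h.ne_one (by norm_num)
  · have := h.pow_ne_one_of_pos_of_lt (l := 2) (by norm_num) (by norm_num)
    rw [pow_two] at this
    exact this

theorem sum_phase_eq_zero_of_ne_one {i j k l : C} (g : C → rootsOfUnity 3 ℂ)
    (hg : phase g i * star (phase g j) * (star (phase g k) * phase g l) ≠ 1) :
    ∑ z : C → rootsOfUnity 3 ℂ,
      phase z i * star (phase z j) * (star (phase z k) * phase z l) = 0 := by
  let F : (C → rootsOfUnity 3 ℂ) →* ℂ :=
    { toFun := fun z => phase z i * star (phase z j) * (star (phase z k) * phase z l)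
      map_one' := by simp [phase]
      map_mul' := fun x y => by simp [phase]; ring }
  exact sum_hom_units_eq_zero F fun h => hg (DFunLike.congr_fun h g)

/-- The fourth moments of random phases. Third roots of unity suffice; signs would not, since
`z i ^ 2` has to average to zero. -/
theorem sum_phase_four (i j k l : C) :
    ∑ z : C → rootsOfUnity 3 ℂ,
        phase z i * star (phase z j) * (star (phase z k) * phase z l)
      = if i = j then (if k = l then (Fintype.card (C → rootsOfUnity 3 ℂ) : ℂ) else 0)
        else if i = k ∧ j = l then (Fintype.card (C → rootsOfUnity 3 ℂ) : ℂ) else 0 := by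
  obtain ⟨ζ, h1, h2⟩ := exists_rootsOfUnity_three
  have h1' : (starRingEnd ℂ) ((ζ : ℂˣ) : ℂ) ≠ 1 := fun h => h1 (by
    rw [← Complex.conj_conj ((ζ : ℂˣ) : ℂ), h, map_one])
  have hs : ∀ t s, phase (Pi.mulSingle t ζ : C → rootsOfUnity 3 ℂ) s
      = if s = t then ((ζ : ℂˣ) : ℂ) else 1 := by
    intro t s
    by_cases h : s = t
    · subst h; simp [phase]
    · simp [phase, h]
  have hc : ∀ z : C → rootsOfUnity 3 ℂ, ∀ i, phase z i * star (phase z i) = 1 := fun z i => by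
    rw [mul_comm, star_phase_mul_phase]
  by_cases hij : i = j
  · subst hij
    rw [if_pos rfl]
    by_cases hkl : k = l
    · subst hkl
      simp only [hc, star_phase_mul_phase, if_true, Finset.sum_const, Finset.card_univ,
        nsmul_eq_mul, mul_one]
    · rw [if_neg hkl]
      refine sum_phase_eq_zero_of_ne_one (Pi.mulSingle l ζ) ?_
      rw [hc, hs, hs, if_neg hkl, if_pos rfl]
      simpa using h1
  · rw [if_neg hij]
    by_cases hik : i = k
    · subst hik
      by_cases hjl : j = l
      · subst hjl
        rw [if_pos ⟨rfl, rfl⟩]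
        have : ∀ z : C → rootsOfUnity 3 ℂ,
            phase z i * star (phase z j) * (star (phase z i) * phase z j) = 1 := fun z => by
          calc _ = (phase z i * star (phase z i)) * (star (phase z j) * phase z j) := by ring
            _ = 1 := by rw [hc, star_phase_mul_phase, one_mul]
        simp only [this, Finset.sum_const, Finset.card_univ, nsmul_eq_mul, mul_one]
      · rw [if_neg fun h => hjl h.2]
        refine sum_phase_eq_zero_of_ne_one (Pi.mulSingle j ζ) ?_
        rw [hs, hs, hs, if_neg hij, if_pos rfl, if_neg (Ne.symm hjl)]
        simpa using h1'
    · rw [if_neg fun h => hik h.1]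
      refine sum_phase_eq_zero_of_ne_one (Pi.mulSingle i ζ) ?_
      rw [hs, hs, hs, hs, if_pos rfl, if_neg (Ne.symm hij), if_neg (Ne.symm hik)]
      by_cases hl : l = i
      · simpa [hl] using h2
      · simpa [hl] using h1

theorem sum_phase_norm_sq (a : Matrix C C ℂ) :
    ∑ z : C → rootsOfUnity 3 ℂ, ‖∑ i, ∑ j, phase z i * star (phase z j) * a i j‖ ^ 2
      = Fintype.card (C → rootsOfUnity 3 ℂ) * (offSq a + ‖a.trace‖ ^ 2) := by
  apply Complex.ofReal_injective
  set N : ℂ := (Fintype.card (C → rootsOfUnity 3 ℂ) : ℂ) with hN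
  have hexp : ∀ z : C → rootsOfUnity 3 ℂ,
      ((‖∑ i, ∑ j, phase z i * star (phase z j) * a i j‖ ^ 2 : ℝ) : ℂ)
        = ∑ i, ∑ j, ∑ k, ∑ l, a i j * star (a k l)
            * (phase z i * star (phase z j) * (star (phase z k) * phase z l)) := by
    intro z
    push_cast
    rw [← Complex.mul_conj', map_sum, Finset.sum_mul]
    refine Finset.sum_congr rfl fun i _ => ?_
    rw [Finset.sum_mul]
    refine Finset.sum_congr rfl fun j _ => ?_
    rw [Finset.mul_sum]
    refine Finset.sum_congr rfl fun k _ => ?_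
    rw [map_sum, Finset.mul_sum]
    refine Finset.sum_congr rfl fun l _ => ?_
    simp only [map_mul, Complex.star_def, Complex.conj_conj]
    ring
  have hsum : ∀ i j, ∑ k, ∑ l, a i j * star (a k l)
      * (if i = j then (if k = l then N else 0) else if i = k ∧ j = l then N else 0)
        = N * ((if i = j then 0 else ((‖a i j‖ ^ 2 : ℝ) : ℂ))
          + if i = j then a i i * star a.trace else 0) := by
    intro i j
    by_cases hij : i = j
    · subst hij
      simp only [if_true, mul_ite, mul_zero, Finset.sum_ite_eq, Finset.mem_univ, zero_add,
        Matrix.trace, Matrix.diag, star_sum, Finset.mul_sum]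
      exact Finset.sum_congr rfl fun k _ => by ring
    · simp only [if_neg hij, ite_and, mul_ite, mul_zero, add_zero]
      rw [Finset.sum_eq_single i (fun k _ hk => by simp [Ne.symm hk]) (by simp)]
      simp only [if_true, Finset.sum_ite_eq, Finset.mem_univ]
      rw [Complex.star_def, Complex.mul_conj']
      push_cast
      ring
  rw [Complex.ofReal_sum]
  simp_rw [hexp]
  have hcomm : ∑ z : C → rootsOfUnity 3 ℂ, ∑ i, ∑ j, ∑ k, ∑ l, a i j * star (a k l)
            * (phase z i * star (phase z j) * (star (phase z k) * phase z l))
      = ∑ i, ∑ j, ∑ k, ∑ l, a i j * star (a k l) * ∑ z : C → rootsOfUnity 3 ℂ,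
            (phase z i * star (phase z j) * (star (phase z k) * phase z l)) := by
    simp_rw [Finset.mul_sum]
    rw [Finset.sum_comm]
    refine Finset.sum_congr rfl fun i _ => ?_
    rw [Finset.sum_comm]
    refine Finset.sum_congr rfl fun j _ => ?_
    rw [Finset.sum_comm]
    refine Finset.sum_congr rfl fun k _ => ?_
    rw [Finset.sum_comm]
  rw [hcomm]
  simp_rw [sum_phase_four, ← hN, hsum, ← Finset.mul_sum, Finset.sum_add_distrib]
  simp only [Finset.sum_ite_eq, Finset.mem_univ, if_true, ← Finset.sum_mul]
  have ht : (∑ i, a i i) * star a.trace = ((‖a.trace‖ ^ 2 : ℝ) : ℂ) := by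
    rw [Complex.star_def]
    push_cast
    rw [← Complex.mul_conj']
    rfl
  rw [ht, offSq]
  push_cast
  congr 2
  refine Finset.sum_congr rfl fun i _ => Finset.sum_congr rfl fun j _ => ?_
  split_ifs <;> simp

end Phases

/-! ### Averages over permutations -/

section Permutations

variable {C : Type*} [Fintype C] [DecidableEq C]

theorem exists_perm_apply_eq_apply_eq {C : Type*} [DecidableEq C]
    {i j k l : C} (hij : i ≠ j) (hkl : k ≠ l) :
    ∃ τ : Equiv.Perm C, τ k = i ∧ τ l = j := by
  refine ⟨Equiv.swap (Equiv.swap k i l) j * Equiv.swap k i, ?_, ?_⟩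
  · have h1 : i ≠ Equiv.swap k i l := fun h => hkl (by
      have := congrArg (Equiv.swap k i) h
      simpa using this)
    simp [Equiv.swap_apply_of_ne_of_ne h1 hij]
  · simp

theorem sum_perm_pair {i j k l : C} (hij : i ≠ j) (hkl : k ≠ l) (h : C → C → ℝ) :
    ∑ σ : Equiv.Perm C, h (σ i) (σ j) = ∑ σ : Equiv.Perm C, h (σ k) (σ l) := by
  obtain ⟨τ, h1, h2⟩ := exists_perm_apply_eq_apply_eq hij hkl
  rw [← Equiv.sum_comp (Equiv.mulRight τ) fun σ : Equiv.Perm C => h (σ k) (σ l)]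
  simp [h1, h2]

theorem sum_sum_ite_ne (h : C → C → ℝ) :
    ∑ i, ∑ j, (if i = j then 0 else h i j) = ∑ i, ∑ j, h i j - ∑ i, h i i := by
  rw [← Finset.sum_sub_distrib]
  refine Finset.sum_congr rfl fun i _ => ?_
  rw [← Finset.add_sum_erase _ _ (Finset.mem_univ i),
    ← Finset.add_sum_erase Finset.univ (h i) (Finset.mem_univ i), if_pos rfl, zero_add,
    add_sub_cancel_left]
  exact Finset.sum_congr rfl fun j hj => if_neg (Finset.ne_of_mem_erase hj).symm

/-- The symmetric group is doubly transitive, so a permutation moves a given pair of distinct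
points to a uniformly distributed such pair. -/
theorem card_mul_sum_perm_pair {i j : C} (hij : i ≠ j) (h : C → C → ℝ) :
    (Fintype.card C : ℝ) * (Fintype.card C - 1) * ∑ σ : Equiv.Perm C, h (σ i) (σ j)
      = Fintype.card (Equiv.Perm C) * ∑ k, ∑ l, if k = l then 0 else h k l := by
  have h1 : ∑ k, ∑ l, (if k = l then 0 else ∑ σ : Equiv.Perm C, h (σ k) (σ l))
      = (Fintype.card C : ℝ) * (Fintype.card C - 1) * ∑ σ : Equiv.Perm C, h (σ i) (σ j) := by
    have : ∀ k l : C, (if k = l then 0 else ∑ σ : Equiv.Perm C, h (σ k) (σ l))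
        = if k = l then 0 else ∑ σ : Equiv.Perm C, h (σ i) (σ j) := by
      intro k l
      split_ifs with hkl
      · rfl
      · exact sum_perm_pair hkl hij h
    simp_rw [this]
    rw [sum_sum_ite_ne fun _ _ => ∑ σ : Equiv.Perm C, h (σ i) (σ j)]
    simp only [Finset.sum_const, Finset.card_univ, nsmul_eq_mul]
    ring
  rw [← h1]
  have h2 : ∀ σ : Equiv.Perm C, ∑ k, ∑ l, (if k = l then 0 else h (σ k) (σ l))
      = ∑ k, ∑ l, if k = l then 0 else h k l := by
    intro σ
    rw [sum_sum_ite_ne fun k l => h (σ k) (σ l), sum_sum_ite_ne h,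
      Equiv.sum_comp σ fun k => ∑ l, h k (σ l), Equiv.sum_comp σ fun k => h k k]
    simp_rw [Equiv.sum_comp σ]
  calc ∑ k, ∑ l, (if k = l then 0 else ∑ σ : Equiv.Perm C, h (σ k) (σ l))
      = ∑ σ : Equiv.Perm C, ∑ k, ∑ l, (if k = l then 0 else h (σ k) (σ l)) := by
        symm
        rw [Finset.sum_comm]
        refine Finset.sum_congr rfl fun k _ => ?_
        rw [Finset.sum_comm]
        refine Finset.sum_congr rfl fun l _ => ?_
        split_ifs <;> simp
    _ = _ := by simp_rw [h2]; simp

/-- The average over the permutations of a sum over the off-diagonal pairs in a relation with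
classes of size `k`. -/
theorem sum_perm_sum_rel [Nonempty C] (r : C → C → Prop) [DecidableRel r] (hr : ∀ i, r i i)
    (k : ℕ) (hk : ∀ i, ∑ j, (if r i j then 1 else 0 : ℝ) = k) (h : C → C → ℝ) :
    ((Fintype.card C : ℝ) - 1) * ∑ σ : Equiv.Perm C, ∑ i, ∑ j,
        (if i = j then 0 else if r i j then h (σ i) (σ j) else 0)
      = (k - 1) * Fintype.card (Equiv.Perm C) * ∑ i, ∑ j, if i = j then 0 else h i j := by
  have hc : (Fintype.card C : ℝ) ≠ 0 := by exact_mod_cast Fintype.card_ne_zero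
  have hcount : ∑ i, ∑ j, (if i = j then 0 else if r i j then 1 else 0 : ℝ)
      = Fintype.card C * (k - 1) := by
    rw [sum_sum_ite_ne fun i j => if r i j then (1 : ℝ) else 0]
    simp_rw [hk, if_pos (hr _)]
    simp
    ring
  -- both sides are multiplied by `card C`, since the number of pairs in question is
  -- `card C * (k - 1)` and the average over pairs involves `card C * (card C - 1)`
  apply mul_left_cancel₀ hc
  calc (Fintype.card C : ℝ) * (((Fintype.card C : ℝ) - 1) * ∑ σ : Equiv.Perm C, ∑ i, ∑ j,
        (if i = j then 0 else if r i j then h (σ i) (σ j) else 0))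
      = (Fintype.card C : ℝ) * ((Fintype.card C : ℝ) - 1) * ∑ i, ∑ j, ∑ σ : Equiv.Perm C,
        (if i = j then 0 else if r i j then h (σ i) (σ j) else 0) := by
        rw [mul_assoc, Finset.sum_comm]
        simp_rw [Finset.sum_comm (s := (Finset.univ : Finset (Equiv.Perm C)))]
    _ = ∑ i, ∑ j, (if i = j then 0 else if r i j then 1 else 0 : ℝ)
          * (Fintype.card (Equiv.Perm C) * ∑ k, ∑ l, if k = l then 0 else h k l) := by
        simp_rw [Finset.mul_sum (s := (Finset.univ : Finset C))]
        refine Finset.sum_congr rfl fun i _ => Finset.sum_congr rfl fun j _ => ?_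
        split_ifs with hij hrij
        · simp
        · simp_rw [← Finset.mul_sum]
          rw [card_mul_sum_perm_pair hij, one_mul]
        · simp
    _ = _ := by
        simp_rw [← Finset.sum_mul]
        rw [hcount]
        ring

end Permutations

/-! ### Partial traces under random monomial matrices -/

section Defect

variable {C D E : Type*} [Fintype C] [DecidableEq C] [Fintype D] [DecidableEq D]
  [Fintype E] [DecidableEq E]

/-- The difference between the partial trace of `n` over `E`, for an identification
`ε : C ≃ D × E`, and the multiple of the identity with the same trace. -/
def defect (ε : C ≃ D × E) (n : Matrix C C ℂ) : Matrix D D ℂ :=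
  fun a b => ∑ x, n (ε.symm (a, x)) (ε.symm (b, x))
    - if a = b then n.trace / Fintype.card D else 0

theorem sum_sum_apply_symm {C D E : Type*} [Fintype C] [Fintype D] [Fintype E]
    (ε : C ≃ D × E) (f : C → ℂ) :
    ∑ a, ∑ x, f (ε.symm (a, x)) = ∑ i, f i := by
  rw [← Fintype.sum_prod_type', ← Equiv.sum_comp ε.symm f]

theorem defect_eq_sum (ε : C ≃ D × E) (n : Matrix C C ℂ) (a b : D) :
    defect ε n a b = ∑ i, ∑ j,
      ((if (ε i).1 = a ∧ (ε j).1 = b ∧ (ε i).2 = (ε j).2 then n i j else 0)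
        - if a = b ∧ i = j then n i i / Fintype.card D else 0) := by
  simp_rw [Finset.sum_sub_distrib]
  rw [defect]
  congr 1
  · rw [← Equiv.sum_comp ε.symm, Fintype.sum_prod_type]
    simp_rw [← Equiv.sum_comp ε.symm (fun j => ite _ _ _), Fintype.sum_prod_type]
    simp [ite_and, Finset.sum_ite_irrel]
  · by_cases hab : a = b
    · simp [hab, Matrix.trace, Finset.sum_div]
    · simp [hab]

theorem defect_apply_self (ε : C ≃ D × E) (n : Matrix C C ℂ) (a : D) :
    defect ε n a a = ∑ i,
      ((if (ε i).1 = a then n i i else 0) - n i i / Fintype.card D) := by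
  rw [defect_eq_sum]
  refine Finset.sum_congr rfl fun i _ => ?_
  rw [Finset.sum_eq_single i]
  · simp
  · intro j _ hj
    have : ¬((ε i).1 = a ∧ (ε j).1 = a ∧ (ε i).2 = (ε j).2) := by
      rintro ⟨h1, h2, h3⟩
      exact hj (ε.injective (Prod.ext (h2.trans h1.symm) h3.symm))
    simp [this, Ne.symm hj]
  · simp

/-- Averaging over the phases removes the interference between different off-diagonal entries. -/
theorem sum_phase_frobSq_defect (ε : C ≃ D × E) (n : Matrix C C ℂ) :
    ∑ z : C → rootsOfUnity 3 ℂ,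
        frobSq (defect ε (Matrix.of fun i j => phase z i * star (phase z j) * n i j))
      = Fintype.card (C → rootsOfUnity 3 ℂ) *
        (∑ i, ∑ j, (if i = j then 0 else if (ε i).2 = (ε j).2 then ‖n i j‖ ^ 2 else 0)
          + ∑ a, ‖defect ε n a a‖ ^ 2) := by
  -- the entries of the defect are linear in `n`, with coefficient matrices `α a b`
  let α : D → D → Matrix C C ℂ := fun a b => Matrix.of fun i j =>
    (if (ε i).1 = a ∧ (ε j).1 = b ∧ (ε i).2 = (ε j).2 then n i j else 0)
        - if a = b ∧ i = j then n i i / Fintype.card D else 0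
  have h1 : ∀ (z : C → rootsOfUnity 3 ℂ) a b,
      defect ε (Matrix.of fun i j => phase z i * star (phase z j) * n i j) a b
        = ∑ i, ∑ j, phase z i * star (phase z j) * α a b i j := by
    intro z a b
    rw [defect_eq_sum]
    refine Finset.sum_congr rfl fun i _ => Finset.sum_congr rfl fun j _ => ?_
    simp only [α, Matrix.of_apply, mul_sub, mul_ite, mul_zero]
    congr 1
    split_ifs with h
    · rw [← h.2, mul_comm (phase z i), star_phase_mul_phase, one_mul, one_mul]
    · rfl
  have h2 : ∀ a b, (α a b).trace = if a = b then defect ε n a a else 0 := by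
    intro a b
    by_cases hab : a = b
    · subst hab
      rw [if_pos rfl, defect_apply_self]
      simp [α, Matrix.trace]
    · rw [if_neg hab]
      refine Finset.sum_eq_zero fun i _ => ?_
      have : ¬((ε i).1 = a ∧ (ε i).1 = b) := fun h => hab (h.1.symm.trans h.2)
      simp [α, hab]
      tauto
  have h3 : ∑ a, ∑ b, offSq (α a b)
      = ∑ i, ∑ j, (if i = j then 0 else if (ε i).2 = (ε j).2 then ‖n i j‖ ^ 2 else 0) := by
    simp_rw [offSq]
    have : ∀ a b i j, (if i = j then 0 else ‖α a b i j‖ ^ 2)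
        = if (ε i).1 = a then (if (ε j).1 = b then
          (if i = j then 0 else if (ε i).2 = (ε j).2 then ‖n i j‖ ^ 2 else 0) else 0) else 0 := by
      intro a b i j
      by_cases hij : i = j
      · simp [hij]
      · by_cases h1 : (ε i).1 = a <;> by_cases h2 : (ε j).1 = b <;>
          by_cases h3 : (ε i).2 = (ε j).2 <;> simp [α, hij, h1, h2, h3]
    simp_rw [this]
    calc _ = ∑ i, ∑ j, ∑ a, ∑ b, (if (ε i).1 = a then (if (ε j).1 = b then
          (if i = j then 0 else if (ε i).2 = (ε j).2 then ‖n i j‖ ^ 2 else 0) else 0) else 0) := by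
          simp_rw [Finset.sum_comm (s := (Finset.univ : Finset D)) (t := (Finset.univ : Finset C))]
      _ = _ := by
          refine Finset.sum_congr rfl fun i _ => Finset.sum_congr rfl fun j _ => ?_
          rw [Finset.sum_eq_single (ε i).1 (fun a _ ha => by simp [Ne.symm ha]) (by simp),
            Finset.sum_eq_single (ε j).1 (fun a _ ha => by simp [Ne.symm ha]) (by simp)]
          simp
  have h4 : ∑ a, ∑ b, ‖(α a b).trace‖ ^ 2 = ∑ a, ‖defect ε n a a‖ ^ 2 := by
    refine Finset.sum_congr rfl fun a _ => ?_
    rw [Finset.sum_eq_single a (fun b _ hb => by simp [h2, Ne.symm hb]) (by simp), h2, if_pos rfl]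
  simp_rw [frobSq, h1]
  rw [Finset.sum_comm]
  simp_rw [Finset.sum_comm (s := (Finset.univ : Finset (C → rootsOfUnity 3 ℂ)))
    (t := (Finset.univ : Finset D)), sum_phase_norm_sq]
  rw [← h3, ← h4]
  simp_rw [← Finset.mul_sum, Finset.sum_add_distrib]

theorem norm_sq_sum_eq {C : Type*} [Fintype C]
    (f : C → ℂ) :
    ‖∑ i, f i‖ ^ 2 = ∑ i, ∑ j, (f i * star (f j)).re := by
  have h : ((‖∑ i, f i‖ ^ 2 : ℝ) : ℂ) = ∑ i, ∑ j, f i * star (f j) := by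
    push_cast
    rw [← Complex.mul_conj', map_sum, Finset.sum_mul_sum]
    rfl
  have := congrArg Complex.re h
  rw [Complex.ofReal_re] at this
  simpa only [Complex.re_sum] using this

theorem re_mul_star_self (z : ℂ) : (z * star z).re = ‖z‖ ^ 2 := by
  rw [Complex.star_def, Complex.mul_conj']
  norm_cast

/-- The diagonal of the defect depends on the diagonal of `n` only. -/
theorem sum_norm_sq_defect_apply_self [Nonempty D] (ε : C ≃ D × E) (n : Matrix C C ℂ) :
    ∑ a, ‖defect ε n a a‖ ^ 2
      = (diagSq n + ∑ i, ∑ j, (if i = j then 0 else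
          if (ε i).1 = (ε j).1 then (n i i * star (n j j)).re else 0))
        - ‖n.trace‖ ^ 2 / Fintype.card D := by
  have hd : (Fintype.card D : ℂ) ≠ 0 := by exact_mod_cast Fintype.card_ne_zero
  have hd' : (Fintype.card D : ℝ) ≠ 0 := by exact_mod_cast Fintype.card_ne_zero
  let s : D → ℂ := fun a => ∑ i, if (ε i).1 = a then n i i else 0
  have hs : ∑ a, s a = n.trace := by
    simp only [s]
    rw [Finset.sum_comm]
    simp [Matrix.trace]
  have hdef : ∀ a, defect ε n a a = s a - n.trace / Fintype.card D := by
    intro a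
    rw [defect_apply_self, Finset.sum_sub_distrib, ← Finset.sum_div]
    rfl
  have h1 : ∀ a, ‖defect ε n a a‖ ^ 2 = ‖s a‖ ^ 2
      - 2 * (s a * star n.trace).re / Fintype.card D
      + ‖n.trace‖ ^ 2 / (Fintype.card D) ^ 2 := by
    intro a
    rw [hdef, ← re_mul_star_self, ← re_mul_star_self, ← re_mul_star_self]
    have : n.trace / (Fintype.card D : ℂ) = (((Fintype.card D : ℝ)⁻¹ : ℝ) : ℂ) * n.trace := by
      push_cast
      field_simp
    rw [this]
    simp only [Complex.star_def, map_sub, map_mul, Complex.conj_ofReal, Complex.sub_re,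
      Complex.mul_re, Complex.sub_im, Complex.mul_im, Complex.ofReal_re, Complex.ofReal_im,
      Complex.conj_re, Complex.conj_im]
    field_simp
    ring
  have h2 : ∑ a, ‖s a‖ ^ 2
      = ∑ i, ∑ j, (if (ε i).1 = (ε j).1 then (n i i * star (n j j)).re else 0) := by
    simp only [s, norm_sq_sum_eq]
    rw [Finset.sum_comm]
    refine Finset.sum_congr rfl fun i _ => ?_
    rw [Finset.sum_comm]
    refine Finset.sum_congr rfl fun j _ => ?_
    rw [Finset.sum_eq_single (ε i).1 (fun a _ ha => by simp [Ne.symm ha]) (by simp)]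
    by_cases h : (ε i).1 = (ε j).1
    · simp [h]
    · simp [h, Ne.symm h]
  have h3 := sum_sum_ite_ne fun i j =>
    (if (ε i).1 = (ε j).1 then (n i i * star (n j j)).re else 0)
  simp only [if_true] at h3
  have h4 : ∑ i, (n i i * star (n i i)).re = diagSq n :=
    Finset.sum_congr rfl fun i _ => re_mul_star_self _
  rw [h4] at h3
  simp_rw [h1, Finset.sum_add_distrib, Finset.sum_sub_distrib, ← Finset.sum_div, ← Finset.mul_sum,
    ← Complex.re_sum, ← Finset.sum_mul, hs, re_mul_star_self, h2]
  rw [h3]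
  simp only [Finset.sum_const, Finset.card_univ, nsmul_eq_mul]
  field_simp
  ring

theorem card_eq_of_equiv {C D E : Type*} [Fintype C] [Fintype D] [Fintype E]
    (ε : C ≃ D × E) :
    (Fintype.card C : ℝ) = Fintype.card D * Fintype.card E := by
  rw [Fintype.card_congr ε, Fintype.card_prod]
  push_cast
  rfl

theorem sum_sum_re_ite_ne (n : Matrix C C ℂ) :
    ∑ i, ∑ j, (if i = j then 0 else (n i i * star (n j j)).re) = ‖n.trace‖ ^ 2 - diagSq n := by
  rw [sum_sum_ite_ne fun i j => (n i i * star (n j j)).re, ← norm_sq_sum_eq]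
  simp_rw [re_mul_star_self]
  rfl

/-- The average of the squared defect over the conjugations by monomial matrices. -/
theorem sum_perm_sum_phase_frobSq_defect [Nonempty C] (ε : C ≃ D × E) (n : Matrix C C ℂ) :
    ((Fintype.card C : ℝ) - 1) * ∑ σ : Equiv.Perm C, ∑ z : C → rootsOfUnity 3 ℂ,
        frobSq (defect ε
          (Matrix.of fun i j => phase z i * star (phase z j) * n.submatrix σ σ i j))
      = Fintype.card (Equiv.Perm C) * Fintype.card (C → rootsOfUnity 3 ℂ)
        * ((Fintype.card D - 1)
          * (frobSq n + (Fintype.card E - 1) * diagSq n - ‖n.trace‖ ^ 2 / Fintype.card D)) := by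
  have : Nonempty (D × E) := ⟨ε (Classical.arbitrary C)⟩
  have : Nonempty D := ⟨(Classical.arbitrary (D × E)).1⟩
  have hd : (Fintype.card D : ℝ) ≠ 0 := by exact_mod_cast Fintype.card_ne_zero
  have hoff := sum_perm_sum_rel (fun i j => (ε i).2 = (ε j).2) (fun _ => rfl) (Fintype.card D)
    (fun i => by
      rw [← Equiv.sum_comp ε.symm, Fintype.sum_prod_type]
      simp) (fun i j => ‖n i j‖ ^ 2)
  have hdiag := sum_perm_sum_rel (fun i j => (ε i).1 = (ε j).1) (fun _ => rfl) (Fintype.card E)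
    (fun i => by
      rw [← Equiv.sum_comp ε.symm, Fintype.sum_prod_type, Finset.sum_comm]
      simp) (fun i j => (n i i * star (n j j)).re)
  rw [sum_sum_re_ite_ne] at hdiag
  change _ = _ * offSq n at hoff
  have htr : ∀ σ : Equiv.Perm C, (n.submatrix σ σ).trace = n.trace := fun σ =>
    Equiv.sum_comp σ fun i => n i i
  have hds : ∀ σ : Equiv.Perm C, diagSq (n.submatrix σ σ) = diagSq n := fun σ =>
    Equiv.sum_comp σ fun i => ‖n i i‖ ^ 2
  simp_rw [sum_phase_frobSq_defect, sum_norm_sq_defect_apply_self,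
    htr, hds, Matrix.submatrix_apply, ← Finset.mul_sum, Finset.sum_add_distrib,
    Finset.sum_sub_distrib, Finset.sum_add_distrib]
  simp only [Finset.sum_const, Finset.card_univ, nsmul_eq_mul]
  have hfrob := offSq_add_diagSq n
  have hc := card_eq_of_equiv ε
  rw [mul_left_comm, mul_add, hoff, mul_sub, mul_add ((Fintype.card C : ℝ) - 1), hdiag, ← hfrob, hc]
  field_simp
  ring

end Defect

/-! ### A unitary 2-design and decoupling -/

section Design

variable {C D E : Type*} [Fintype C] [DecidableEq C] [Fintype D] [DecidableEq D]
  [Fintype E] [DecidableEq E]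

/-- The monomial matrix with entries `z i` at the positions `(i, σ i)`. -/
def monomial (σ : Equiv.Perm C) (z : C → rootsOfUnity 3 ℂ) : Matrix C C ℂ :=
  Matrix.of fun i j => if σ i = j then phase z i else 0

theorem monomial_mul_mul_conjTranspose (σ : Equiv.Perm C) (z : C → rootsOfUnity 3 ℂ)
    (n : Matrix C C ℂ) : monomial σ z * n * (monomial σ z).conjTranspose
      = Matrix.of fun i j => phase z i * star (phase z j) * n.submatrix σ σ i j := by
  ext i j
  simp [monomial, Matrix.mul_apply, Matrix.conjTranspose_apply, apply_ite]
  ring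

theorem monomial_isIsometry (σ : Equiv.Perm C) (z : C → rootsOfUnity 3 ℂ) :
    IsIsometry (monomial σ z) := by
  have h := monomial_mul_mul_conjTranspose σ z 1
  rw [Matrix.mul_one] at h
  refine mul_eq_one_comm.1 (h.trans ?_)
  ext i j
  by_cases hij : i = j
  · subst hij
    rw [Matrix.of_apply, mul_comm (phase z i), star_phase_mul_phase]
    simp
  · simp [hij]

theorem IsIsometry.mul {ι κ τ : Type*} [Fintype ι] [Fintype κ] [Fintype τ] [DecidableEq ι]
    [DecidableEq κ] {V : Matrix τ κ ℂ} {W : Matrix κ ι ℂ} (hV : IsIsometry V)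
    (hW : IsIsometry W) : IsIsometry (V * W) := by
  have hV' : V.conjTranspose * V = 1 := hV
  rw [IsIsometry, Matrix.conjTranspose_mul, Matrix.mul_assoc, ← Matrix.mul_assoc _ V, hV',
    Matrix.one_mul]
  exact hW

theorem frobSq_conj {U : Matrix C C ℂ} (hU : IsIsometry U) (m : Matrix C C ℂ) :
    frobSq (U * m * U.conjTranspose) = frobSq m := by
  have h := frobSq_conj_unitary (V := U.conjTranspose)
    (by rw [Matrix.conjTranspose_conjTranspose]; exact hU) m
  rwa [Matrix.conjTranspose_conjTranspose] at h

theorem trace_conj {U : Matrix C C ℂ} (hU : IsIsometry U) (m : Matrix C C ℂ) :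
    (U * m * U.conjTranspose).trace = m.trace := by
  have hU' : U.conjTranspose * U = 1 := hU
  rw [Matrix.trace_mul_comm, ← Matrix.mul_assoc, hU', Matrix.one_mul]

/-- The discrete Fourier transform: a unitary matrix all of whose entries have the same absolute
value. -/
theorem exists_isometry_norm_sq_eq (C : Type*) [Fintype C] [DecidableEq C] [Nonempty C] :
    ∃ H : Matrix C C ℂ, IsIsometry H ∧ ∀ i j, ‖H i j‖ ^ 2 = (Fintype.card C : ℝ)⁻¹ := by
  set N := Fintype.card C with hN
  have hN0 : N ≠ 0 := Fintype.card_ne_zero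
  have : NeZero N := ⟨hN0⟩
  have hNc : (N : ℂ) ≠ 0 := by exact_mod_cast hN0
  let e : C ≃ ZMod N := Fintype.equivOfCardEq (by rw [ZMod.card])
  let H : Matrix C C ℂ := Matrix.of fun i j =>
    (((√(N : ℝ))⁻¹ : ℝ) : ℂ) * ZMod.stdAddChar (e i * e j)
  have hsq : (√(N : ℝ))⁻¹ * (√(N : ℝ))⁻¹ = (N : ℝ)⁻¹ := by
    rw [← mul_inv, Real.mul_self_sqrt (Nat.cast_nonneg N)]
  refine ⟨H, ?_, fun i j => ?_⟩
  · ext i j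
    rw [Matrix.mul_apply]
    have h1 : ∀ k, H.conjTranspose i k * H k j
        = (N : ℂ)⁻¹ * ZMod.stdAddChar (e k * (e j - e i)) := by
      intro k
      simp only [H, Matrix.conjTranspose_apply, Matrix.of_apply, star_mul', Complex.star_def,
        Complex.conj_ofReal]
      rw [mul_sub, sub_eq_add_neg, AddChar.map_add_eq_mul, AddChar.map_neg_eq_conj]
      have : (((√(N : ℝ))⁻¹ : ℝ) : ℂ) * (((√(N : ℝ))⁻¹ : ℝ) : ℂ) = (N : ℂ)⁻¹ := by
        rw [← Complex.ofReal_mul, hsq]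
        push_cast
        rfl
      rw [← this]
      ring
    simp_rw [h1, ← Finset.mul_sum]
    rw [Equiv.sum_comp e fun k => (ZMod.stdAddChar (k * (e j - e i)) : ℂ),
      AddChar.sum_mulShift _ (ZMod.isPrimitive_stdAddChar N), Matrix.one_apply]
    by_cases hij : i = j
    · subst hij
      simp [hNc]
    · have : e j - e i ≠ 0 := sub_ne_zero.2 fun h => hij (e.injective h).symm
      simp [this, hij]
  · simp only [H, Matrix.of_apply, norm_mul, Complex.norm_real, AddChar.norm_apply, mul_one,
      Real.norm_eq_abs, sq_abs]
    rw [pow_two, hsq]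

/-- The average of the diagonal over the phases, in the basis given by `H`. -/
theorem sum_phase_diagSq [Nonempty C] {H : Matrix C C ℂ}
    (hH : ∀ i j, ‖H i j‖ ^ 2 = (Fintype.card C : ℝ)⁻¹) (m : Matrix C C ℂ) :
    Fintype.card C * ∑ z : C → rootsOfUnity 3 ℂ,
        diagSq ((H * monomial 1 z) * m * (H * monomial 1 z).conjTranspose)
      = Fintype.card (C → rootsOfUnity 3 ℂ) * (frobSq m - diagSq m + ‖m.trace‖ ^ 2) := by
  have hc : (Fintype.card C : ℝ) ≠ 0 := by exact_mod_cast Fintype.card_ne_zero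
  let α : C → Matrix C C ℂ := fun a => Matrix.of fun i j => H a i * m i j * star (H a j)
  have h1 : ∀ (z : C → rootsOfUnity 3 ℂ) a,
      ((H * monomial 1 z) * m * (H * monomial 1 z).conjTranspose) a a
        = ∑ i, ∑ j, phase z i * star (phase z j) * α a i j := by
    intro z a
    have : (H * monomial 1 z) * m * (H * monomial 1 z).conjTranspose
        = H * (monomial 1 z * m * (monomial 1 z).conjTranspose) * H.conjTranspose := by
      rw [Matrix.conjTranspose_mul]
      simp only [Matrix.mul_assoc]
    rw [this, monomial_mul_mul_conjTranspose, Matrix.mul_apply]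
    simp_rw [Matrix.mul_apply, Finset.sum_mul]
    rw [Finset.sum_comm]
    refine Finset.sum_congr rfl fun i _ => Finset.sum_congr rfl fun j _ => ?_
    simp [α]
    ring
  have h2 : ∀ a, offSq (α a) = ((Fintype.card C : ℝ)⁻¹) ^ 2 * offSq m := by
    intro a
    rw [offSq, offSq, Finset.mul_sum]
    refine Finset.sum_congr rfl fun i _ => ?_
    rw [Finset.mul_sum]
    refine Finset.sum_congr rfl fun j _ => ?_
    split_ifs
    · simp
    · simp only [α, Matrix.of_apply, norm_mul, norm_star, mul_pow, hH]
      ring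
  have h3 : ∀ a, ‖(α a).trace‖ ^ 2 = ((Fintype.card C : ℝ)⁻¹) ^ 2 * ‖m.trace‖ ^ 2 := by
    intro a
    have : (α a).trace = (Fintype.card C : ℂ)⁻¹ * m.trace := by
      rw [Matrix.trace, Matrix.trace, Finset.mul_sum]
      refine Finset.sum_congr rfl fun i _ => ?_
      simp only [α, Matrix.diag_apply, Matrix.of_apply]
      rw [mul_right_comm, Complex.star_def, Complex.mul_conj', ← Complex.ofReal_pow, hH]
      push_cast
      rfl
    rw [this, norm_mul, mul_pow]
    simp
  simp_rw [diagSq, h1]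
  rw [Finset.sum_comm]
  simp_rw [sum_phase_norm_sq, h2, h3]
  simp only [Finset.sum_const, Finset.card_univ, nsmul_eq_mul]
  rw [← offSq_add_diagSq m, diagSq]
  field_simp
  ring

theorem defect_eq_zero_of_card_eq_one {C D E : Type*} [Fintype C] [Fintype D] [DecidableEq D]
    [Fintype E]
    (hD : Fintype.card D = 1) (ε : C ≃ D × E)
    (n : Matrix C C ℂ) : defect ε n = 0 := by
  obtain ⟨d, hd⟩ := Fintype.card_eq_one_iff.1 hD
  ext a b
  rw [hd a, hd b, defect, if_pos rfl, hD, Matrix.trace, ← sum_sum_apply_symm ε]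
  rw [Finset.sum_eq_single d (fun a _ ha => absurd (hd a) ha) (by simp)]
  simp

/-- The index type of a finite family of unitaries which is, with the weights `designWeight`, a
unitary 2-design. An index consists of the phases that go with `H`, or `none` if `H` is not applied,
and of the permutation and the phases of the monomial matrix. -/
abbrev DesignIndex (C : Type*) : Type _ :=
  Option (C → rootsOfUnity 3 ℂ) × Equiv.Perm C × (C → rootsOfUnity 3 ℂ)

/-- The unitaries of the family: a random monomial matrix, preceded with a certain probability by
random phases and the transformation `H` to a basis unbiased to the standard one. -/
def designUnitary (H : Matrix C C ℂ) (ω : DesignIndex C) : Matrix C C ℂ :=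
  monomial ω.2.1 ω.2.2 * (ω.1.elim 1 fun z => H * monomial 1 z)

/-- The unnormalized probabilities. There are as many indices with `some z` for each `z` as there
are with `none`, so `H` is applied with probability `d / (d + 1)`, where `d` is the dimension of
`C`. -/
def designWeight (ω : DesignIndex C) : ℝ :=
  ω.1.elim (Fintype.card (C → rootsOfUnity 3 ℂ) : ℝ) fun _ => Fintype.card C

theorem designWeight_pos [Nonempty C] (ω : DesignIndex C) : 0 < designWeight ω := by
  rcases ω with ⟨_ | z, ω⟩
  · exact Nat.cast_pos.2 (Fintype.card_pos (α := C → rootsOfUnity 3 ℂ))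
  · exact Nat.cast_pos.2 (Fintype.card_pos (α := C))

theorem designUnitary_isIsometry {H : Matrix C C ℂ} (hH : IsIsometry H) (ω : DesignIndex C) :
    IsIsometry (designUnitary H ω) := by
  refine (monomial_isIsometry _ _).mul ?_
  rcases ω with ⟨_ | z, ω⟩
  · simp [IsIsometry]
  · exact hH.mul (monomial_isIsometry _ _)

theorem sum_designWeight [Nonempty C] : ∑ ω : DesignIndex C, designWeight ω
    = (Fintype.card C + 1) * Fintype.card (C → rootsOfUnity 3 ℂ)
      * (Fintype.card (Equiv.Perm C) * Fintype.card (C → rootsOfUnity 3 ℂ)) := by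
  rw [Fintype.sum_prod_type, Fintype.sum_option]
  simp only [designWeight, Option.elim_none, Option.elim_some, Finset.sum_const, Finset.card_univ,
    nsmul_eq_mul, Fintype.card_prod]
  push_cast
  ring

/-- Decoupling on average: a random unitary of the design makes the partial trace over `E` close to
a multiple of the identity. -/
theorem sum_design_frobSq_defect_le [Nonempty C] {H : Matrix C C ℂ} (hH1 : IsIsometry H)
    (hH2 : ∀ i j, ‖H i j‖ ^ 2 = (Fintype.card C : ℝ)⁻¹) (ε : C ≃ D × E) (m : Matrix C C ℂ) :
    ∑ ω : DesignIndex C, designWeight ω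
        * frobSq (defect ε (designUnitary H ω * m * (designUnitary H ω).conjTranspose))
      ≤ (∑ ω : DesignIndex C, designWeight ω) * (frobSq m / Fintype.card E) := by
  have : Nonempty (D × E) := ⟨ε (Classical.arbitrary C)⟩
  have : Nonempty D := ⟨(Classical.arbitrary (D × E)).1⟩
  have : Nonempty E := ⟨(Classical.arbitrary (D × E)).2⟩
  have hwpos : ∀ ω : DesignIndex C, 0 ≤ designWeight ω := fun ω => (designWeight_pos ω).le
  -- the averages are known up to the factor `card C - 1`, which is nonzero unless `card D = 1`
  by_cases hD : Fintype.card D = 1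
  · simp only [defect_eq_zero_of_card_eq_one hD]
    have h0 : frobSq (0 : Matrix D D ℂ) = 0 := by simp [frobSq]
    simp only [h0, mul_zero, Finset.sum_const_zero]
    exact mul_nonneg (Finset.sum_nonneg fun ω _ => hwpos ω)
      (div_nonneg (frobSq_nonneg m) (Nat.cast_nonneg _))
  have hd2 : (2 : ℝ) ≤ Fintype.card D := by
    have : 0 < Fintype.card D := Fintype.card_pos
    exact_mod_cast (by omega : 2 ≤ Fintype.card D)
  have he1 : (1 : ℝ) ≤ Fintype.card E := by exact_mod_cast Fintype.card_pos (α := E)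
  have hcde := card_eq_of_equiv ε
  set N : ℝ := (Fintype.card (C → rootsOfUnity 3 ℂ) : ℝ) with hN
  set P : ℝ := (Fintype.card (Equiv.Perm C) : ℝ) with hP
  have hN0 : 0 < N := Nat.cast_pos.2 Fintype.card_pos
  have hP0 : 0 < P := Nat.cast_pos.2 Fintype.card_pos
  set c : ℝ := (Fintype.card C : ℝ) with hc
  set d : ℝ := (Fintype.card D : ℝ) with hd
  set e : ℝ := (Fintype.card E : ℝ) with he
  have hc1 : 0 < c - 1 := by rw [hcde]; nlinarith
  set t : ℝ := ‖m.trace‖ ^ 2 with ht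
  have ht0 : 0 ≤ t := by positivity
  let G : Matrix C C ℂ → ℝ := fun n => frobSq n + (e - 1) * diagSq n - ‖n.trace‖ ^ 2 / d
  -- the average over the monomial matrices, for a fixed choice of what precedes them
  have hmono : ∀ U : Matrix C C ℂ, (c - 1) * ∑ p : Equiv.Perm C × (C → rootsOfUnity 3 ℂ),
      frobSq (defect ε ((monomial p.1 p.2 * U) * m * (monomial p.1 p.2 * U).conjTranspose))
        = P * N * ((d - 1) * G (U * m * U.conjTranspose)) := by
    intro U
    have h : ∀ p : Equiv.Perm C × (C → rootsOfUnity 3 ℂ),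
        (monomial p.1 p.2 * U) * m * (monomial p.1 p.2 * U).conjTranspose
          = Matrix.of fun i j => phase p.2 i * star (phase p.2 j)
            * (U * m * U.conjTranspose).submatrix p.1 p.1 i j := by
      intro p
      rw [← monomial_mul_mul_conjTranspose, Matrix.conjTranspose_mul]
      simp only [Matrix.mul_assoc]
    simp_rw [h]
    rw [Fintype.sum_prod_type]
    exact sum_perm_sum_phase_frobSq_defect ε (U * m * U.conjTranspose)
  have hG1 : G ((1 : Matrix C C ℂ) * m * (1 : Matrix C C ℂ).conjTranspose)
      = frobSq m + (e - 1) * diagSq m - t / d := by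
    simp [G, ht]
  have hG2 : ∀ z : C → rootsOfUnity 3 ℂ,
      G ((H * monomial 1 z) * m * (H * monomial 1 z).conjTranspose)
        = frobSq m
          + (e - 1) * diagSq ((H * monomial 1 z) * m * (H * monomial 1 z).conjTranspose)
          - t / d := by
    intro z
    have := hH1.mul (monomial_isIsometry 1 z)
    simp only [G]
    rw [frobSq_conj this, trace_conj this]
  have htotal : (c - 1) * ∑ ω : DesignIndex C, designWeight ω
        * frobSq (defect ε (designUnitary H ω * m * (designUnitary H ω).conjTranspose))
      = N * (P * N * ((d - 1) * ((c + e) * frobSq m + (e - 1 - (c + 1) / d) * t))) := by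
    rw [Fintype.sum_prod_type, Fintype.sum_option]
    simp only [designWeight, designUnitary, Option.elim_none, Option.elim_some, ← Finset.mul_sum,
      ← hc, ← hN]
    rw [mul_add, mul_left_comm, hmono, hG1, mul_left_comm (c - 1) c, Finset.mul_sum]
    simp_rw [hmono, hG2, ← Finset.mul_sum]
    rw [Finset.sum_sub_distrib, Finset.sum_add_distrib, ← Finset.mul_sum]
    simp only [Finset.sum_const, Finset.card_univ, nsmul_eq_mul]
    have h := sum_phase_diagSq hH2 m
    rw [← hN, ← hc, ← ht] at h
    rw [← hN]
    linear_combination (P * N * (d - 1) * (e - 1)) * h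
  have hcoef : (e - 1 - (c + 1) / d) * t ≤ 0 := by
    refine mul_nonpos_of_nonpos_of_nonneg ?_ ht0
    rw [hcde, sub_nonpos, le_div_iff₀ (by linarith)]
    nlinarith
  rw [sum_designWeight, ← hN, ← hP, ← hc]
  refine le_of_mul_le_mul_left ?_ hc1
  rw [htotal]
  have hF := frobSq_nonneg m
  have hkey : (d - 1) * ((c + e) * frobSq m + (e - 1 - (c + 1) / d) * t)
      ≤ (c - 1) * (c + 1) * (frobSq m / e) := by
    have h1 : (d - 1) * ((c + e) * frobSq m + (e - 1 - (c + 1) / d) * t)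
        ≤ (d - 1) * ((c + e) * frobSq m) :=
      mul_le_mul_of_nonneg_left (by linarith) (by linarith)
    refine h1.trans ?_
    have h2 : (d - 1) * (c + e) * e ≤ (c - 1) * (c + 1) := by
      rw [hcde]
      nlinarith
    calc (d - 1) * ((c + e) * frobSq m) = ((d - 1) * (c + e) * e) * (frobSq m / e) := by
          field_simp
      _ ≤ _ := mul_le_mul_of_nonneg_right h2 (by positivity)
  calc N * (P * N * ((d - 1) * ((c + e) * frobSq m + (e - 1 - (c + 1) / d) * t)))
      ≤ N * (P * N * ((c - 1) * (c + 1) * (frobSq m / e))) := by gcongr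
    _ = _ := by ring

/-- One unitary decouples two families of operators at once, at the cost of a factor of `2`. -/
theorem exists_isometry_sum_frobSq_defect_le [Nonempty C] {D' E' K K' : Type*} [Fintype D']
    [DecidableEq D'] [Fintype E'] [DecidableEq E'] [Fintype K] [Fintype K']
    (ε : C ≃ D × E) (ε' : C ≃ D' × E') (m : K → Matrix C C ℂ) (m' : K' → Matrix C C ℂ)
    (hm : 0 < ∑ k, frobSq (m k)) (hm' : 0 < ∑ k, frobSq (m' k)) :
    ∃ U : Matrix C C ℂ, IsIsometry U ∧
      ∑ k, frobSq (defect ε (U * m k * U.conjTranspose))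
        ≤ 2 * (∑ k, frobSq (m k)) / Fintype.card E ∧
      ∑ k, frobSq (defect ε' (U * m' k * U.conjTranspose))
        ≤ 2 * (∑ k, frobSq (m' k)) / Fintype.card E' := by
  obtain ⟨H, hH1, hH2⟩ := exists_isometry_norm_sq_eq C
  have : Nonempty (D × E) := ⟨ε (Classical.arbitrary C)⟩
  have : Nonempty (D' × E') := ⟨ε' (Classical.arbitrary C)⟩
  have : Nonempty E := ⟨(Classical.arbitrary (D × E)).2⟩
  have : Nonempty E' := ⟨(Classical.arbitrary (D' × E')).2⟩
  have he : (0 : ℝ) < Fintype.card E := by exact_mod_cast Fintype.card_pos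
  have he' : (0 : ℝ) < Fintype.card E' := by exact_mod_cast Fintype.card_pos
  set b := (∑ k, frobSq (m k)) / Fintype.card E with hb
  set b' := (∑ k, frobSq (m' k)) / Fintype.card E' with hb'
  have hb0 : 0 < b := div_pos hm he
  have hb0' : 0 < b' := div_pos hm' he'
  let g : DesignIndex C → ℝ := fun ω => ∑ k, frobSq
    (defect ε (designUnitary H ω * m k * (designUnitary H ω).conjTranspose))
  let g' : DesignIndex C → ℝ := fun ω => ∑ k, frobSq
    (defect ε' (designUnitary H ω * m' k * (designUnitary H ω).conjTranspose))
  have hg : ∑ ω, designWeight ω * g ω ≤ (∑ ω : DesignIndex C, designWeight ω) * b := by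
    simp only [g, Finset.mul_sum]
    rw [Finset.sum_comm, hb, Finset.sum_div, Finset.mul_sum]
    exact Finset.sum_le_sum fun k _ => sum_design_frobSq_defect_le hH1 hH2 ε (m k)
  have hg' : ∑ ω, designWeight ω * g' ω ≤ (∑ ω : DesignIndex C, designWeight ω) * b' := by
    simp only [g', Finset.mul_sum]
    rw [Finset.sum_comm, hb', Finset.sum_div, Finset.mul_sum]
    exact Finset.sum_le_sum fun k _ => sum_design_frobSq_defect_le hH1 hH2 ε' (m' k)
  have hsum : ∑ ω : DesignIndex C, designWeight ω * (g ω / b + g' ω / b')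
      ≤ ∑ ω : DesignIndex C, designWeight ω * 2 := by
    have h1 : ∑ ω : DesignIndex C, designWeight ω * (g ω / b + g' ω / b')
        = (∑ ω, designWeight ω * g ω) / b + (∑ ω, designWeight ω * g' ω) / b' := by
      rw [Finset.sum_div, Finset.sum_div, ← Finset.sum_add_distrib]
      exact Finset.sum_congr rfl fun ω _ => by ring
    rw [h1, ← Finset.sum_mul, mul_two]
    exact add_le_add ((div_le_iff₀ hb0).2 hg) ((div_le_iff₀ hb0').2 hg')
  obtain ⟨ω, -, hω⟩ := Finset.exists_le_of_sum_le Finset.univ_nonempty hsum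
  have hω2 := le_of_mul_le_mul_left hω (designWeight_pos ω)
  have hg0 : 0 ≤ g ω := Finset.sum_nonneg fun k _ => frobSq_nonneg _
  have hg0' : 0 ≤ g' ω := Finset.sum_nonneg fun k _ => frobSq_nonneg _
  refine ⟨designUnitary H ω, designUnitary_isIsometry hH1 ω, ?_, ?_⟩
  · rw [mul_div_assoc]
    exact (div_le_iff₀ hb0).1 (by have := div_nonneg hg0' hb0'.le; linarith)
  · rw [mul_div_assoc]
    exact (div_le_iff₀ hb0').1 (by have := div_nonneg hg0 hb0.le; linarith)

end Design

/-! ### Pure states and isometries -/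

section States

variable {ι κ τ S T X : Type*} [Fintype ι] [DecidableEq ι] [Fintype κ] [DecidableEq κ]
  [Fintype τ] [DecidableEq τ] [Fintype S] [DecidableEq S] [Fintype T] [DecidableEq T]
  [Fintype X] [DecidableEq X]

theorem IsPureState.nonempty {ι : Type*} [Fintype ι]
    {ψ : ι → ℂ} (hψ : IsPureState ψ) : Nonempty ι := by
  by_contra h
  rw [not_nonempty_iff] at h
  simp [IsPureState] at hψ

theorem IsPureState.mulVec {ι κ : Type*} [Fintype ι] [DecidableEq ι] [Fintype κ]
    {K : Matrix κ ι ℂ} (hK : IsIsometry K) {ψ : ι → ℂ}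
    (hψ : IsPureState ψ) : IsPureState (K.mulVec ψ) := by
  have h := frobSq_isometry_mul hK (Matrix.replicateCol Unit ψ)
  have h2 : K * Matrix.replicateCol Unit ψ = Matrix.replicateCol Unit (K.mulVec ψ) := by
    ext i j
    rfl
  rw [h2] at h
  simp only [frobSq, Matrix.replicateCol_apply, Finset.univ_unique, Finset.sum_singleton] at h
  exact h.trans hψ

theorem IsIsometry.kronecker_one {ι κ X : Type*} [Fintype κ] [DecidableEq ι] [Fintype X]
    [DecidableEq X]
    {W : Matrix κ ι ℂ} (hW : IsIsometry W) :
    IsIsometry (W ⊗ₖ (1 : Matrix X X ℂ)) := by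
  have hW' : W.conjTranspose * W = 1 := hW
  rw [IsIsometry, Matrix.conjTranspose_kronecker, ← Matrix.mul_kronecker_mul, hW',
    Matrix.conjTranspose_one, Matrix.one_mul, Matrix.one_kronecker_one]

theorem IsIsometry.submatrix {ι κ S T : Type*} [Fintype κ] [DecidableEq ι] [Fintype S]
    [DecidableEq T]
    {W : Matrix κ ι ℂ} (hW : IsIsometry W) (e₁ : S ≃ κ) (e₂ : T ≃ ι) :
    IsIsometry (W.submatrix e₁ e₂) := by
  have hW' : W.conjTranspose * W = 1 := hW
  rw [IsIsometry, Matrix.conjTranspose_submatrix, Matrix.submatrix_mul_equiv, hW',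
    Matrix.submatrix_one_equiv]

theorem kronecker_one_submatrix_mulVec {ι κ S T X : Type*} [Fintype ι] [Fintype T] [Fintype X]
    [DecidableEq X]
    (W : Matrix κ ι ℂ) (e₁ : S ≃ κ × X) (e₂ : T ≃ ι × X)
    (ψ : T → ℂ) (s : S) :
    ((W ⊗ₖ (1 : Matrix X X ℂ)).submatrix e₁ e₂).mulVec ψ s
      = (W * Matrix.of fun i x => ψ (e₂.symm (i, x))) (e₁ s).1 (e₁ s).2 := by
  rw [Matrix.mulVec, dotProduct, ← Equiv.sum_comp e₂.symm, Fintype.sum_prod_type,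
    Matrix.mul_apply]
  refine Finset.sum_congr rfl fun i _ => ?_
  rw [Finset.sum_eq_single (e₁ s).2]
  · simp [Matrix.kroneckerMap_apply]
  · intro x _ hx
    simp [Matrix.kroneckerMap_apply, Ne.symm hx]
  · simp

/-- Two pure states of bipartite systems with nearby reduced states on `X` are related, up to a
small error in trace norm, by an isometry acting on the other factor only. -/
theorem exists_isometry_traceNorm_act_sub_le (e₁ : S ≃ κ × X) (e₂ : T ≃ ι × X) {ψ : T → ℂ}
    {χ : S → ℂ} (hψ : IsPureState ψ) (hχ : IsPureState χ)
    (hcard : Fintype.card ι ≤ Fintype.card κ) (M : Matrix ι X ℂ)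
    (hM : ∀ i x, M i x = ψ (e₂.symm (i, x))) (N : Matrix κ X ℂ)
    (hN : ∀ k x, N k x = χ (e₁.symm (k, x))) :
    ∃ W : Matrix κ ι ℂ, IsIsometry W ∧
      traceNorm (act ((W ⊗ₖ (1 : Matrix X X ℂ)).submatrix e₁ e₂) (density ψ) - density χ)
        ≤ 2 * √(√(Fintype.card X) *
          √(frobSq (M.conjTranspose * M - N.conjTranspose * N))) := by
  obtain ⟨W, hW, hle⟩ := exists_isometry_frobSq_mul_sub_le hcard M N
  refine ⟨W, hW, ?_⟩
  have hK : IsIsometry ((W ⊗ₖ (1 : Matrix X X ℂ)).submatrix e₁ e₂) :=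
    hW.kronecker_one.submatrix e₁ e₂
  rw [act_density]
  refine (traceNorm_density_sub_le (hψ.mulVec hK) hχ).trans ?_
  refine mul_le_mul_of_nonneg_left (Real.sqrt_le_sqrt (le_trans (le_of_eq ?_) hle)) zero_le_two
  have hM' : (Matrix.of fun i x => ψ (e₂.symm (i, x))) = M := by
    ext i x
    exact (hM i x).symm
  rw [← Equiv.sum_comp e₁.symm, Fintype.sum_prod_type, frobSq]
  refine Finset.sum_congr rfl fun k _ => Finset.sum_congr rfl fun x _ => ?_
  rw [kronecker_one_submatrix_mulVec, hM', Matrix.sub_apply, hN]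
  simp

theorem density_kronecker_density {S T : Type*}
    (Φ : S → ℂ) (φ : T → ℂ) :
    density Φ ⊗ₖ density φ = density fun x : S × T => Φ x.1 * φ x.2 := by
  ext ⟨s, t⟩ ⟨s', t'⟩
  simp [density, Matrix.vecMulVec_apply, Matrix.kroneckerMap_apply]
  ring

theorem IsPureState.prod {S T : Type*} [Fintype S] [Fintype T]
    {Φ : S → ℂ} {φ : T → ℂ} (hΦ : IsPureState Φ) (hφ : IsPureState φ) :
    IsPureState fun x : S × T => Φ x.1 * φ x.2 := by
  have hΦ' : ∑ i, ‖Φ i‖ ^ 2 = 1 := hΦ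
  have hφ' : ∑ i, ‖φ i‖ ^ 2 = 1 := hφ
  simp only [IsPureState, norm_mul, mul_pow]
  rw [Fintype.sum_prod_type]
  simp_rw [← Finset.mul_sum, hφ', mul_one, hΦ']

/-- Tensoring with a pure state does not increase the trace norm: it is the conjugation by an
isometry. -/
theorem traceNorm_density_kronecker_le {Φ : S → ℂ} (hΦ : IsPureState Φ) (M : Matrix T T ℂ) :
    traceNorm (density Φ ⊗ₖ M) ≤ traceNorm M := by
  let J : Matrix (S × T) T ℂ := Matrix.of fun x t => Φ x.1 * if x.2 = t then 1 else 0
  have hJ : IsIsometry J := by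
    ext t t'
    have hΦ' : ∑ i, ((‖Φ i‖ ^ 2 : ℝ) : ℂ) = 1 := by exact_mod_cast hΦ
    rw [Matrix.mul_apply, Fintype.sum_prod_type, Matrix.one_apply]
    have : ∀ s, ∑ u, J.conjTranspose t (s, u) * J (s, u) t'
        = ((‖Φ s‖ ^ 2 : ℝ) : ℂ) * if t = t' then 1 else 0 := by
      intro s
      rw [Finset.sum_eq_single t (fun u _ hu => by simp [J, hu]) (by simp)]
      simp only [J, Matrix.conjTranspose_apply, Matrix.of_apply, if_true, mul_one]
      rw [← mul_assoc, Complex.star_def, Complex.conj_mul']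
      push_cast
      rfl
    simp_rw [this, ← Finset.sum_mul, hΦ', one_mul]
  have hact : act J M = density Φ ⊗ₖ M := by
    ext ⟨s, t⟩ ⟨s', t'⟩
    simp [act, J, Matrix.mul_apply, density, Matrix.vecMulVec_apply, Matrix.kroneckerMap_apply,
      apply_ite]
    ring
  rw [← hact]
  exact hJ.isContraction.traceNorm_act_le M

theorem act_sub {ι κ : Type*} [Fintype ι]
    (K : Matrix κ ι ℂ) (ρ σ : Matrix ι ι ℂ) : act K (ρ - σ) = act K ρ - act K σ := by
  simp [act, Matrix.mul_sub, Matrix.sub_mul]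

theorem act_mul {ι κ τ : Type*} [Fintype ι] [Fintype κ]
    (K : Matrix τ κ ℂ) (L : Matrix κ ι ℂ) (ρ : Matrix ι ι ℂ) :
    act (K * L) ρ = act K (act L ρ) := by
  simp [act, Matrix.conjTranspose_mul, Matrix.mul_assoc]

/-- Replacing the reference state by the given state costs `γ`. -/
theorem traceNorm_act_sub_le_gammaError_add {Φ : S → ℂ} (hΦ : IsPureState Φ) (φ χ : T → ℂ)
    {K : Matrix (S × T) T ℂ} (hK : IsContraction K) {r : ℝ}
    (h : traceNorm (act K (density χ) - density Φ ⊗ₖ density χ) ≤ r) :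
    traceNorm (act K (density φ) - density Φ ⊗ₖ density φ) ≤ gammaError φ χ + r := by
  have h1 : traceNorm (act K (density φ) - act K (density χ))
      ≤ traceNorm (density φ - density χ) := by
    rw [← act_sub]
    exact hK.traceNorm_act_le _
  have h2 : traceNorm (density Φ ⊗ₖ density χ - density Φ ⊗ₖ density φ)
      ≤ traceNorm (density φ - density χ) := by
    have : density Φ ⊗ₖ density χ - density Φ ⊗ₖ density φ
        = density Φ ⊗ₖ (density χ - density φ) := by
      ext ⟨s, t⟩ ⟨s', t'⟩
      simp [Matrix.kroneckerMap_apply, mul_sub]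
    rw [this, traceNorm_sub_rev (density φ)]
    exact traceNorm_density_kronecker_le hΦ _
  have h3 := traceNorm_sub_le (act K (density φ)) (act K (density χ)) (density Φ ⊗ₖ density φ)
  have h4 := traceNorm_sub_le (act K (density χ)) (density Φ ⊗ₖ density χ)
    (density Φ ⊗ₖ density φ)
  rw [gammaError]
  linarith

/-- If `W` and `V` take the same state `ρ` close to `ω` and to `ω'`, then `V Wᴴ` takes `ω` close
to `ω'`. -/
theorem traceNorm_act_mul_conjTranspose_sub_le {V : Matrix κ ι ℂ} {W : Matrix τ ι ℂ}
    (hV : IsIsometry V) (hW : IsIsometry W) (ρ : Matrix ι ι ℂ) {ω : Matrix τ τ ℂ}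
    {ω' : Matrix κ κ ℂ} {r r' : ℝ} (h : traceNorm (act W ρ - ω) ≤ r)
    (h' : traceNorm (act V ρ - ω') ≤ r') :
    traceNorm (act (V * W.conjTranspose) ω - ω') ≤ r + r' := by
  have hW' : W.conjTranspose * W = 1 := hW
  have h1 : act (V * W.conjTranspose) (act W ρ) = act V ρ := by
    rw [← act_mul, Matrix.mul_assoc, hW', Matrix.mul_one]
  have h2 : traceNorm (act (V * W.conjTranspose) ω - act V ρ) ≤ r := by
    rw [← h1, ← act_sub]
    refine ((hV.isContraction.mul hW.isContraction.conjTranspose).traceNorm_act_le _).trans ?_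
    rwa [traceNorm_sub_rev]
  exact (traceNorm_sub_le _ _ _).trans (add_le_add h2 h')

theorem purity_eq_frobSq {ι : Type*} [Fintype ι]
    {ρ : Matrix ι ι ℂ} (h : ρ.IsHermitian) : purity ρ = frobSq ρ := by
  rw [frobSq_eq_re_trace, h.eq, purity]

end States

/-! ### Blocks of reduced states -/

section Blocks

/-- The operator on `C` which is the block with index `y` of the reduced state on `C Y` of a vector
of `C P Y`. -/
def reducedBlock {C P Y : Type*} [Fintype P] (χ : C → P → Y → ℂ) (y : Y × Y) : Matrix C C ℂ :=
  Matrix.of fun i j => ∑ p, χ i p y.1 * star (χ j p y.2)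

theorem purity_eq_sum_frobSq_reducedBlock {C P Y : Type*} [Fintype C] [DecidableEq C] [Fintype P]
    [Fintype Y] [DecidableEq Y]
    (χ : C → P → Y → ℂ)
    (ρ : Matrix (C × Y) (C × Y) ℂ)
    (hρ : ∀ x x', ρ x x' = reducedBlock χ (x.2, x'.2) x.1 x'.1) :
    purity ρ = ∑ y, frobSq (reducedBlock χ y) := by
  have hH : ρ.IsHermitian := by
    ext x x'
    rw [Matrix.conjTranspose_apply, hρ, hρ]
    simp [reducedBlock, mul_comm]
  rw [purity_eq_frobSq hH, frobSq]
  simp_rw [frobSq, hρ, Fintype.sum_prod_type]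
  rw [Finset.sum_comm]
  refine Finset.sum_congr rfl fun y _ => ?_
  symm
  rw [Finset.sum_comm]
  refine Finset.sum_congr rfl fun i _ => ?_
  rw [Finset.sum_comm]

theorem sum_frobSq_reducedBlock_pos {C P Y : Type*} [Fintype C] [Fintype P] [Fintype Y]
    (χ : C → P → Y → ℂ) (h : ∃ i p y, χ i p y ≠ 0) :
    0 < ∑ y, frobSq (reducedBlock χ y) := by
  obtain ⟨i, p, y, h⟩ := h
  refine Finset.sum_pos' (fun y _ => frobSq_nonneg _) ⟨(y, y), Finset.mem_univ _, ?_⟩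
  refine Finset.sum_pos' (fun i _ => by positivity) ⟨i, Finset.mem_univ _, ?_⟩
  refine Finset.sum_pos' (fun i _ => by positivity) ⟨i, Finset.mem_univ _, ?_⟩
  have h1 : reducedBlock χ (y, y) i i = ((∑ p, ‖χ i p y‖ ^ 2 : ℝ) : ℂ) := by
    simp [reducedBlock, Complex.mul_conj']
  have h2 : 0 < ∑ p, ‖χ i p y‖ ^ 2 :=
    Finset.sum_pos' (fun i _ => by positivity) ⟨p, Finset.mem_univ _, by positivity⟩
  rw [h1, Complex.norm_real]
  exact pow_pos (norm_pos_iff.2 h2.ne') 2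

theorem reducedBlock_mul {C P Y : Type*} [Fintype C] [Fintype P]
    (U : Matrix C C ℂ) (χ : C → P → Y → ℂ) (y : Y × Y) :
    reducedBlock (fun i p y => ∑ j, U i j * χ j p y) y
      = U * reducedBlock χ y * U.conjTranspose := by
  ext i j
  simp only [reducedBlock, Matrix.of_apply, Matrix.mul_apply, Matrix.conjTranspose_apply, star_sum,
    Finset.sum_mul, Finset.mul_sum, star_mul']
  rw [Finset.sum_comm]
  calc _ = ∑ k, ∑ l, ∑ p, U i l * χ l p y.1 * (star (U j k) * star (χ k p y.2)) := by
        refine Finset.sum_congr rfl fun k _ => ?_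
        rw [Finset.sum_comm]
    _ = _ := by
        refine Finset.sum_congr rfl fun k _ => Finset.sum_congr rfl fun l _ =>
          Finset.sum_congr rfl fun p _ => by ring

/-- The reduced states on `D Y` of a vector of `C P Y`, where `C = D E₁ E₂`, and of its tensor
product with a maximally entangled state of `D D'` differ by the defects of the blocks. -/
theorem frobSq_gram_sub_eq_sum_defect {C D D' E₁ E₂ P Y : Type*} [Fintype C] [DecidableEq C]
    [Fintype D] [DecidableEq D] [Fintype D'] [DecidableEq D'] [Fintype E₁] [Fintype E₂] [Fintype P]
    [Fintype Y]
    (ε : C ≃ D × (E₁ × E₂)) {Φ : D × D' → ℂ}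
    (hΦ : IsMaxEntangled Φ) {U : Matrix C C ℂ} (hU : IsIsometry U) (χ : C → P → Y → ℂ)
    (M : Matrix (E₁ × E₂ × P) (D × Y) ℂ)
    (hM : ∀ x a, M x a = ∑ j, U (ε.symm (a.1, x.1, x.2.1)) j * χ j x.2.2 a.2)
    (N : Matrix (D' × C × P) (D × Y) ℂ)
    (hN : ∀ x a, N x a = Φ (a.1, x.1) * χ x.2.1 x.2.2 a.2) :
    frobSq (M.conjTranspose * M - N.conjTranspose * N)
      = ∑ y, frobSq (defect ε (U * reducedBlock χ y * U.conjTranspose)) := by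
  have hΦ' : ∀ a b, ∑ d, Φ (a, d) * star (Φ (b, d))
      = if a = b then (Fintype.card D : ℂ)⁻¹ else 0 := by
    intro a b
    have h := congrFun (congrFun hΦ.fst a) b
    simp only [traceSnd, density, Matrix.vecMulVec_apply, maxMixed, Matrix.smul_apply,
      Matrix.one_apply, Pi.star_apply, smul_eq_mul, mul_ite, mul_one, mul_zero] at h
    exact h
  have hMM : ∀ a b, (M.conjTranspose * M) a b = ∑ x : E₁ × E₂,
      (U * reducedBlock χ (b.2, a.2) * U.conjTranspose) (ε.symm (b.1, x)) (ε.symm (a.1, x)) := by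
    intro a b
    rw [← reducedBlock_mul, Matrix.mul_apply]
    simp only [Fintype.sum_prod_type, reducedBlock, Matrix.of_apply, Matrix.conjTranspose_apply, hM]
    refine Finset.sum_congr rfl fun x _ => Finset.sum_congr rfl fun x' _ =>
      Finset.sum_congr rfl fun p _ => mul_comm _ _
  have hNN : ∀ a b, (N.conjTranspose * N) a b
      = if b.1 = a.1 then (reducedBlock χ (b.2, a.2)).trace / Fintype.card D else 0 := by
    intro a b
    have h1 : (N.conjTranspose * N) a b = (∑ d, Φ (b.1, d) * star (Φ (a.1, d)))
        * (reducedBlock χ (b.2, a.2)).trace := by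
      rw [Matrix.mul_apply, Finset.sum_mul, Fintype.sum_prod_type]
      refine Finset.sum_congr rfl fun d _ => ?_
      rw [Matrix.trace, Finset.mul_sum, Fintype.sum_prod_type]
      refine Finset.sum_congr rfl fun i _ => ?_
      simp only [Matrix.diag_apply, reducedBlock, Matrix.of_apply, Finset.mul_sum,
        Matrix.conjTranspose_apply, hN, star_mul']
      refine Finset.sum_congr rfl fun p _ => ?_
      ring
    rw [h1, hΦ']
    split_ifs
    · rw [div_eq_mul_inv, mul_comm]
    · rw [zero_mul]
  have hentry : ∀ a b, (M.conjTranspose * M - N.conjTranspose * N) a b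
      = defect ε (U * reducedBlock χ (b.2, a.2) * U.conjTranspose) b.1 a.1 := by
    intro a b
    rw [Matrix.sub_apply, hMM, hNN, defect, trace_conj hU]
  rw [frobSq]
  simp_rw [hentry, frobSq, Fintype.sum_prod_type]
  calc _ = ∑ y' : Y, ∑ a : D, ∑ y : Y, ∑ b : D,
        ‖defect ε (U * reducedBlock χ (y, y') * U.conjTranspose) b a‖ ^ 2 := by
        rw [Finset.sum_comm]
        refine Finset.sum_congr rfl fun y' _ => Finset.sum_congr rfl fun a _ => ?_
        rw [Finset.sum_comm]
    _ = ∑ y' : Y, ∑ y : Y, ∑ a : D, ∑ b : D,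
        ‖defect ε (U * reducedBlock χ (y, y') * U.conjTranspose) b a‖ ^ 2 := by
        refine Finset.sum_congr rfl fun y' _ => ?_
        rw [Finset.sum_comm]
    _ = _ := by
        rw [Finset.sum_comm]
        refine Finset.sum_congr rfl fun y _ => Finset.sum_congr rfl fun y' _ => ?_
        rw [Finset.sum_comm]

end Blocks

/-- The bounds for the purification distance and for the decoupling combine to `η`; here `c`, `d`,
`e` and `y` are the dimensions of `C`, of the system kept, of the one traced out, and of the
rest. -/
theorem two_mul_sqrt_sqrt_mul_sqrt_le {c d e y p s : ℝ} (he : 0 < e) (hd : 0 ≤ d) (hy : 0 ≤ y)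
    (hp : 0 ≤ p)    (hc : c = d * e) (hs : s ≤ 2 * p / e) :
    2 * √(√(d * y) * √s) ≤ 2 * (2 * c * y * p / e ^ 2) ^ (1 / 4 : ℝ) := by
  have h1 : √(d * y) * √s ≤ √(2 * c * y * p / e ^ 2) := by
    rw [← Real.sqrt_mul (mul_nonneg hd hy)]
    refine Real.sqrt_le_sqrt ((mul_le_mul_of_nonneg_left hs (mul_nonneg hd hy)).trans_eq ?_)
    rw [hc]
    field_simp
  refine mul_le_mul_of_nonneg_left ((Real.sqrt_le_sqrt h1).trans_eq ?_) zero_le_two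
  rw [Real.sqrt_eq_rpow, Real.sqrt_eq_rpow]
  have h : 0 ≤ 2 * c * y * p / e ^ 2 := by rw [hc]; positivity
  rw [← Real.rpow_mul h]
  norm_num

/-! ### State redistribution -/

section Redistribution

variable {C₁ C₂ C₃ A B R A₂ B₁ : Type*}
  [Fintype C₁] [DecidableEq C₁] [Fintype C₂] [DecidableEq C₂] [Fintype C₃] [DecidableEq C₃]
  [Fintype A] [DecidableEq A] [Fintype B] [DecidableEq B] [Fintype R] [DecidableEq R]
  [Fintype A₂] [DecidableEq A₂] [Fintype B₁] [DecidableEq B₁]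

/-- `C = C₂ (C₁ C₃)`. -/
def keepSecond (C₁ C₂ C₃ : Type*) : C₁ × C₂ × C₃ ≃ C₂ × (C₁ × C₃) where
  toFun x := (x.2.1, x.1, x.2.2)
  invFun y := (y.2.1, y.1, y.2.2)
  left_inv _ := rfl
  right_inv _ := rfl

/-- The blocks, indexed by a pair of basis elements of `B R`, of the reduced state on `C B R`. -/
abbrev blockCBR (χ : (C₁ × C₂ × C₃) × A × B × R → ℂ) :
    (B × R) × (B × R) → Matrix (C₁ × C₂ × C₃) (C₁ × C₂ × C₃) ℂ :=
  reducedBlock fun c (a : A) (y : B × R) => χ (c, a, y.1, y.2)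

/-- The blocks, indexed by a pair of basis elements of `A R`, of the reduced state on `C A R`. -/
abbrev blockCAR (χ : (C₁ × C₂ × C₃) × A × B × R → ℂ) :
    (A × R) × (A × R) → Matrix (C₁ × C₂ × C₃) (C₁ × C₂ × C₃) ℂ :=
  reducedBlock fun c (b : B) (y : A × R) => χ (c, y.1, b, y.2)

theorem purity_reducedCBR {C₁ C₂ C₃ A B R : Type*} [Fintype C₁] [DecidableEq C₁] [Fintype C₂]
    [DecidableEq C₂] [Fintype C₃] [DecidableEq C₃] [Fintype A] [Fintype B] [DecidableEq B]
    [Fintype R] [DecidableEq R]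
    (χ : (C₁ × C₂ × C₃) × A × B × R → ℂ) :
    purity (reducedCBR (density χ)) = ∑ y, frobSq (blockCBR χ y) :=
  purity_eq_sum_frobSq_reducedBlock _ _ fun _ _ => rfl

theorem purity_reducedCAR {C₁ C₂ C₃ A B R : Type*} [Fintype C₁] [DecidableEq C₁] [Fintype C₂]
    [DecidableEq C₂] [Fintype C₃] [DecidableEq C₃] [Fintype A] [DecidableEq A] [Fintype B]
    [Fintype R] [DecidableEq R]
    (χ : (C₁ × C₂ × C₃) × A × B × R → ℂ) :
    purity (reducedCAR (density χ)) = ∑ y, frobSq (blockCAR χ y) :=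
  purity_eq_sum_frobSq_reducedBlock _ _ fun _ _ => rfl

theorem IsPureState.exists_ne_zero {ι : Type*} [Fintype ι] {ψ : ι → ℂ} (hψ : IsPureState ψ) :
    ∃ i, ψ i ≠ 0 := by
  by_contra! h
  simp [IsPureState, h] at hψ

theorem sum_frobSq_blockCBR_pos {C₁ C₂ C₃ A B R : Type*} [Fintype C₁] [Fintype C₂] [Fintype C₃]
    [Fintype A] [Fintype B] [Fintype R]
    {χ : (C₁ × C₂ × C₃) × A × B × R → ℂ} (hχ : IsPureState χ) :
    0 < ∑ y, frobSq (blockCBR χ y) := by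
  obtain ⟨⟨c, a, b, r⟩, h⟩ := hχ.exists_ne_zero
  exact sum_frobSq_reducedBlock_pos _ ⟨c, a, (b, r), h⟩

theorem sum_frobSq_blockCAR_pos {C₁ C₂ C₃ A B R : Type*} [Fintype C₁] [Fintype C₂] [Fintype C₃]
    [Fintype A] [Fintype B] [Fintype R]
    {χ : (C₁ × C₂ × C₃) × A × B × R → ℂ} (hχ : IsPureState χ) :
    0 < ∑ y, frobSq (blockCAR χ y) := by
  obtain ⟨⟨c, a, b, r⟩, h⟩ := hχ.exists_ne_zero
  exact sum_frobSq_reducedBlock_pos _ ⟨c, b, (a, r), h⟩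

/-- The unitary `U` of `C` as an operator on the whole system. -/
abbrev extendC (A B R : Type*) [DecidableEq A] [DecidableEq B] [DecidableEq R]
    (U : Matrix (C₁ × C₂ × C₃) (C₁ × C₂ × C₃) ℂ) :
    Matrix ((C₁ × C₂ × C₃) × A × B × R) ((C₁ × C₂ × C₃) × A × B × R) ℂ :=
  U ⊗ₖ (1 : Matrix (A × B × R) (A × B × R) ℂ)

theorem extendC_mulVec {C₁ C₂ C₃ A B R : Type*} [Fintype C₁] [Fintype C₂] [Fintype C₃]
    [Fintype A] [DecidableEq A] [Fintype B] [DecidableEq B] [Fintype R] [DecidableEq R]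
    (U : Matrix (C₁ × C₂ × C₃) (C₁ × C₂ × C₃) ℂ)
    (χ : (C₁ × C₂ × C₃) × A × B × R → ℂ) (c : C₁ × C₂ × C₃) (y : A × B × R) :
    (extendC A B R U).mulVec χ (c, y) = ∑ j, U c j * χ (j, y) :=
  kronecker_one_submatrix_mulVec U (Equiv.refl _) (Equiv.refl _) χ (c, y)

theorem IsIsometry.extendW {C₁ C₂ C₃ A B R A₂ : Type*} [Fintype C₁] [DecidableEq C₁] [Fintype C₂]
    [DecidableEq C₂] [Fintype C₃] [DecidableEq C₃] [Fintype A] [DecidableEq A] [Fintype B]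
    [DecidableEq B] [Fintype R] [DecidableEq R] [Fintype A₂]
    {W : Matrix (A₂ × (C₁ × C₂ × C₃) × A) (C₁ × C₃ × A) ℂ}
    (hW : IsIsometry W) : IsIsometry (extendW (B := B) (R := R) W) :=
  hW.kronecker_one.submatrix _ _

theorem IsIsometry.extendV {C₁ C₂ C₃ A B R B₁ : Type*} [Fintype C₁] [DecidableEq C₁] [Fintype C₂]
    [DecidableEq C₂] [Fintype C₃] [DecidableEq C₃] [Fintype A] [DecidableEq A] [Fintype B]
    [DecidableEq B] [Fintype R] [DecidableEq R] [Fintype B₁]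
    {V : Matrix (B₁ × (C₁ × C₂ × C₃) × B) (C₂ × C₃ × B) ℂ}
    (hV : IsIsometry V) : IsIsometry (extendV (A := A) (R := R) V) :=
  hV.kronecker_one.submatrix _ _

/-- If `U` decouples `C₂` from `B R`, Alice can turn `U · χ` into the initial state. -/
theorem exists_isometry_extendW {Φ : C₂ × A₂ → ℂ} (hΦ : IsMaxEntangled Φ)
    {χ : (C₁ × C₂ × C₃) × A × B × R → ℂ} (hχ : IsPureState χ)
    {U : Matrix (C₁ × C₂ × C₃) (C₁ × C₂ × C₃) ℂ} (hU : IsIsometry U)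
    (hdec : ∑ y, frobSq (defect (keepSecond C₁ C₂ C₃) (U * blockCBR χ y * U.conjTranspose))
      ≤ 2 * (∑ y, frobSq (blockCBR χ y)) / Fintype.card (C₁ × C₃)) :
    ∃ W : Matrix (A₂ × (C₁ × C₂ × C₃) × A) (C₁ × C₃ × A) ℂ, IsIsometry W ∧
      traceNorm (act (extendW (B := B) (R := R) W * extendC A B R U) (density χ)
        - density Φ ⊗ₖ density χ) ≤ etaOne χ := by
  obtain ⟨c₂, a₂⟩ := hΦ.pure.nonempty.some
  obtain ⟨c, -⟩ := hχ.nonempty.some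
  let M : Matrix (C₁ × C₃ × A) (C₂ × B × R) ℂ := Matrix.of fun x a =>
    (extendC A B R U).mulVec χ ((splitAlice C₁ C₂ C₃ A B R).symm (x, a))
  let N : Matrix (A₂ × (C₁ × C₂ × C₃) × A) (C₂ × B × R) ℂ := Matrix.of fun x a =>
    Φ (a.1, x.1) * χ (x.2.1, x.2.2, a.2.1, a.2.2)
  have hgram := frobSq_gram_sub_eq_sum_defect (keepSecond C₁ C₂ C₃) hΦ hU
    (fun c (a : A) (y : B × R) => χ (c, a, y.1, y.2)) M
    (fun x a => extendC_mulVec U χ _ _) N (fun _ _ => rfl)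
  obtain ⟨W, hW, hle⟩ := exists_isometry_traceNorm_act_sub_le
    (splitInitial C₂ A₂ (C₁ × C₂ × C₃) A B R) (splitAlice C₁ C₂ C₃ A B R)
    (hχ.mulVec (K := extendC A B R U) hU.kronecker_one) (hΦ.pure.prod hχ)
    (Fintype.card_le_of_injective
      (fun x : C₁ × C₃ × A => (a₂, (x.1, c₂, x.2.1), x.2.2))
      (by rintro ⟨x, y, z⟩ ⟨x', y', z'⟩ h; simpa [and_assoc] using h))
    M (fun _ _ => rfl) N (fun _ _ => rfl)
  refine ⟨W, hW, ?_⟩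
  rw [act_mul, act_density (extendC A B R U), density_kronecker_density]
  refine hle.trans ?_
  rw [hgram, Fintype.card_prod, Nat.cast_mul, etaOne, purity_reducedCBR]
  refine two_mul_sqrt_sqrt_mul_sqrt_le ?_ (Nat.cast_nonneg _) (Nat.cast_nonneg _)
    (sum_frobSq_blockCBR_pos hχ).le (card_eq_of_equiv (keepSecond C₁ C₂ C₃)) hdec
  exact Nat.cast_pos.2 (Fintype.card_pos_iff.2 ⟨(c.1, c.2.2)⟩)

/-- If `U` decouples `C₁` from `A R`, Bob can turn `U · χ` into the final state. -/
theorem exists_isometry_extendV {Φ : C₁ × B₁ → ℂ} (hΦ : IsMaxEntangled Φ)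
    {χ : (C₁ × C₂ × C₃) × A × B × R → ℂ} (hχ : IsPureState χ)
    {U : Matrix (C₁ × C₂ × C₃) (C₁ × C₂ × C₃) ℂ} (hU : IsIsometry U)
    (hdec : ∑ y, frobSq (defect (Equiv.refl _) (U * blockCAR χ y * U.conjTranspose))
      ≤ 2 * (∑ y, frobSq (blockCAR χ y)) / Fintype.card (C₂ × C₃)) :
    ∃ V : Matrix (B₁ × (C₁ × C₂ × C₃) × B) (C₂ × C₃ × B) ℂ, IsIsometry V ∧
      traceNorm (act (extendV (A := A) (R := R) V * extendC A B R U) (density χ)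
        - density Φ ⊗ₖ density χ) ≤ etaTwo χ := by
  obtain ⟨c₁, b₁⟩ := hΦ.pure.nonempty.some
  obtain ⟨c, -⟩ := hχ.nonempty.some
  let M : Matrix (C₂ × C₃ × B) (C₁ × A × R) ℂ := Matrix.of fun x a =>
    (extendC A B R U).mulVec χ ((splitBob C₁ C₂ C₃ A B R).symm (x, a))
  let N : Matrix (B₁ × (C₁ × C₂ × C₃) × B) (C₁ × A × R) ℂ := Matrix.of fun x a =>
    Φ (a.1, x.1) * χ (x.2.1, a.2.1, x.2.2, a.2.2)
  have hgram := frobSq_gram_sub_eq_sum_defect (Equiv.refl _) hΦ hU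
    (fun c (b : B) (y : A × R) => χ (c, y.1, b, y.2)) M
    (fun x a => extendC_mulVec U χ _ _) N (fun _ _ => rfl)
  obtain ⟨V, hV, hle⟩ := exists_isometry_traceNorm_act_sub_le
    (splitFinal C₁ B₁ (C₁ × C₂ × C₃) A B R) (splitBob C₁ C₂ C₃ A B R)
    (hχ.mulVec (K := extendC A B R U) hU.kronecker_one) (hΦ.pure.prod hχ)
    (Fintype.card_le_of_injective
      (fun x : C₂ × C₃ × B => (b₁, (c₁, x.1, x.2.1), x.2.2))
      (by rintro ⟨x, y, z⟩ ⟨x', y', z'⟩ h; simpa [and_assoc] using h))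
    M (fun _ _ => rfl) N (fun _ _ => rfl)
  refine ⟨V, hV, ?_⟩
  rw [act_mul, act_density (extendC A B R U), density_kronecker_density]
  refine hle.trans ?_
  rw [hgram, Fintype.card_prod, Nat.cast_mul, etaTwo, purity_reducedCAR]
  refine two_mul_sqrt_sqrt_mul_sqrt_le ?_ (Nat.cast_nonneg _) (Nat.cast_nonneg _)
    (sum_frobSq_blockCAR_pos hχ).le (card_eq_of_equiv (Equiv.refl _)) hdec
  exact Nat.cast_pos.2 (Fintype.card_pos_iff.2 ⟨c.2⟩)

end Redistribution

end QSR

end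

open QSR in
theorem theorem2 {C₁ C₂ C₃ A B R A₂ B₁ : Type*}
    [Fintype C₁] [DecidableEq C₁] [Fintype C₂] [DecidableEq C₂] [Fintype C₃] [DecidableEq C₃]
    [Fintype A] [DecidableEq A] [Fintype B] [DecidableEq B] [Fintype R] [DecidableEq R]
    [Fintype A₂] [DecidableEq A₂] [Fintype B₁] [DecidableEq B₁]
    (ΦCA : C₂ × A₂ → ℂ) (hΦCA : IsMaxEntangled ΦCA)
    (ΦCB : C₁ × B₁ → ℂ) (hΦCB : IsMaxEntangled ΦCB)
    (φ φhat φcheck : (C₁ × C₂ × C₃) × A × B × R → ℂ)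
    (hφ : IsPureState φ) (hφhat : IsPureState φhat) (hφcheck : IsPureState φcheck) :
    ∃ (V : Matrix (B₁ × (C₁ × C₂ × C₃) × B) (C₂ × C₃ × B) ℂ)
      (W : Matrix (A₂ × (C₁ × C₂ × C₃) × A) (C₁ × C₃ × A) ℂ),
      IsIsometry V ∧ IsIsometry W ∧
      traceNorm
          (act (extendV (A := A) (R := R) V * (extendW (B := B) (R := R) W).conjTranspose)
              (density ΦCA ⊗ₖ density φ)
            - density ΦCB ⊗ₖ density φ)
        ≤ (gammaError φ φhat + etaOne φhat) + (gammaError φ φcheck + etaTwo φcheck) ∧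
      traceNorm
          (act (extendW (B := B) (R := R) W * (extendV (A := A) (R := R) V).conjTranspose)
              (density ΦCB ⊗ₖ density φ)
            - density ΦCA ⊗ₖ density φ)
        ≤ (gammaError φ φhat + etaOne φhat) + (gammaError φ φcheck + etaTwo φcheck) := by
  have : Nonempty (C₁ × C₂ × C₃) := ⟨hφ.nonempty.some.1⟩
  obtain ⟨U, hU, hdec₁, hdec₂⟩ := exists_isometry_sum_frobSq_defect_le (keepSecond C₁ C₂ C₃)
    (Equiv.refl _) (blockCBR φhat) (blockCAR φcheck) (sum_frobSq_blockCBR_pos hφhat)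
    (sum_frobSq_blockCAR_pos hφcheck)
  obtain ⟨W, hW, hWle⟩ := exists_isometry_extendW hΦCA hφhat hU hdec₁
  obtain ⟨V, hV, hVle⟩ := exists_isometry_extendV hΦCB hφcheck hU hdec₂
  have hUext : IsIsometry (extendC A B R U) := hU.kronecker_one
  have hWe : IsIsometry (extendW (B := B) (R := R) W) := hW.extendW
  have hVe : IsIsometry (extendV (A := A) (R := R) V) := hV.extendV
  have hα := traceNorm_act_sub_le_gammaError_add hΦCA.pure φ φhat
    (hWe.mul hUext).isContraction hWle
  have hβ := traceNorm_act_sub_le_gammaError_add hΦCB.pure φ φcheck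
    (hVe.mul hUext).isContraction hVle
  rw [act_mul] at hα hβ
  refine ⟨V, W, hV, hW, traceNorm_act_mul_conjTranspose_sub_le hVe hWe _ hα hβ, ?_⟩
  rw [add_comm (gammaError φ φhat + etaOne φhat)]
  exact traceNorm_act_mul_conjTranspose_sub_le hWe hVe _ hβ hα
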